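/- Conventions. A sequence $(f_n)$ of Boolean functions has $f_n:\{0,1\}^n\to\{0,1\}$; a property is a sequence $(C_n)$ of sets of Boolean functions on $n$ variables. Circuits have gates with two inputs, and size is the number of gates. $P/poly=\bigcup_k SIZE(n^k)$, where $(f_n)\in SIZE(\lambda)$ if for some constant $c$ the circuit size of $f_n$ is at most $c\lambda(n)$ for all large $n$. A function $\gamma$ *outstrips* $\lambda$ if for every $c>0$ we have $\gamma(n)>c\lambda(n)$ for all large $n$. Logarithms are to base $2$. Time is that of a random access machine with logarithmic cost and random access to the input bits. A property $(C_n)$ is * *sublinear-natural of density $\delta_n$* if $|C_n|\ge 2^{2^n}\delta_n$ for all large $n$, and membership of $f$ in $C_n$ can be decided, given the truth table of $f$ (of length $N=2^n$), in time $o(N)$; * *useful* (respectively *quasi-useful*) against $P/poly$ if no sequence $(f_n)$ with $f_n\in C_n$ for infinitely many (respectively all sufficiently large) $n$ is in $P/poly$; * *separating $NP$ from $P/poly$* if it is quasi-useful against $P/poly$ and there is a sequence $(f_n)$ in $NP$ (that is, the set of $x$ with $f_{|x|}(x)=1$ is in $NP$) with $f_n\in C_n$ for all $n$. Encode formulas in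 conjunctive normal form as binary strings (in a fixed standard way in which codes may be padded with zeros at the end), and let $SAT_n$ be the Boolean function that says whether an $n$-bit string encodes a satisfiable formula. For $\mu:\mathbb N\to\mathbb N$ let $C^\mu_n$ be the set of all Boolean functions $f$ on $n$ variables such that, for every $x\in\{0,1\}^n$ whose last $n-\mu(n)$ bits are all zero, $f(x)$ is $1$ or $0$ according to whether or not the first $\mu(n)$ bits of $x$ encode a satisfiable formula. (If $\mu(n)>n$, this is to hold with $n$ in place of $\mu(n)$.) **Theorem.** Let $\epsilon>0$ and assume that SAT is not computable by circuits of size $2^{n^\epsilon}$; that is, it is not the case that for all sufficiently large $n$ the function $SAT_n$ has a circuit of size at most $2^{n^\epsilon}$. Let $\gamma:\mathbb N\to\mathbb N$ be a function that outstrips $(\log n)^{1/\epsilon}$ and is computable, given $n$, in time $o(2^n)$. Then there is a function $\mu\le\gamma$, with $\mu=\gamma$ if $n-\gamma(n)$ outstrips $\log n$ (so that $\mathrm{poly}(\gamma(n))\cdot 2^{\gamma(n)}$ is sublinear in $2^n$), such that the property $(C^\mu_n)$ is sublinear-natural of density $2^{-2^{\gamma(n)}}$ and separates $NP$ from $P/poly$;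 and if, for all sufficiently large $n$, $SAT_n$ has no circuit of size at most $2^{n^\epsilon}$, then $(C^\mu_n)$ is even useful against $P/poly$. -/

import Mathlib

open Filter Asymptotics

namespace AlmostNatural

/-! ### Boolean functions, properties, growth -/

/-- Boolean functions on `n` variables. -/
abbrev BoolFun (n : ℕ) : Type := (Fin n → Bool) → Bool

/-- A sequence `(f_n)` of Boolean functions, `f_n` being a function of `n` variables. -/
abbrev BoolFunSeq : Type := (n : ℕ) → BoolFun n

/-- A Boolean function property `(C_n)`: each `C_n` is a set of Boolean functions on
`n` variables. -/
abbrev Property : Type := (n : ℕ) → Set (BoolFun n)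

/-- `γ` outstrips `l`: it eventually exceeds every constant multiple of `l`. -/
def Outstrips (γ l : ℕ → ℝ) : Prop :=
  ∀ c : ℝ, 0 < c → ∃ n₀ : ℕ, ∀ n ≥ n₀, c * l n < γ n

/-! ### Boolean circuits with two-input gates -/

/-- What a gate (or the output) may be connected to when there are `n` input variables and
`k` earlier gates. -/
inductive Wire (n k : ℕ) : Type
  | const (b : Bool)
  | input (i : Fin n)
  | gate (j : Fin k)

/-- The value carried by a wire. -/
def Wire.eval {n k : ℕ} (x : Fin n → Bool) (v : Fin k → Bool) : Wire n k → Bool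
  | .const b => b
  | .input i => x i
  | .gate j => v j

/-- A gate with two inputs, computing an arbitrary binary Boolean operation. -/
structure Gate (n k : ℕ) : Type where
  op : Bool → Bool → Bool
  left : Wire n k
  right : Wire n k

/-- A circuit on `n` variables with `s` gates, listed in topological order. -/
inductive Circuit (n : ℕ) : ℕ → Type
  | nil : Circuit n 0
  | snoc {s : ℕ} (C : Circuit n s) (g : Gate n s) : Circuit n (s + 1)

/-- The values of all gates of a circuit on the input `x`. -/
def Circuit.values {n : ℕ} (x : Fin n → Bool) : {s : ℕ} → Circuit n s → Fin s → Bool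
  | _, .nil => Fin.elim0
  | _, .snoc C g =>
      Fin.snoc (α := fun _ => Bool) (C.values x)
        (g.op (g.left.eval x (C.values x)) (g.right.eval x (C.values x)))

/-- `f` is computed by a circuit with at most `b` gates. -/
def HasCircuitOfSize {n : ℕ} (f : BoolFun n) (b : ℝ) : Prop :=
  ∃ (s : ℕ) (C : Circuit n s) (out : Wire n s),
    (s : ℝ) ≤ b ∧ ∀ x, out.eval x (C.values x) = f x

/-- `SIZE(l)`: circuit size at most `c * l n` for some constant `c` and all large `n`. -/
def InSIZE (l : ℕ → ℝ) (f : BoolFunSeq) : Prop :=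
  ∃ c : ℝ, ∀ᶠ n in atTop, HasCircuitOfSize (f n) (c * l n)

/-- `P/poly`, the union of the classes `SIZE(n ^ k)`. -/
def InPPoly (f : BoolFunSeq) : Prop :=
  ∃ k : ℕ, InSIZE (fun n => (n : ℝ) ^ k) f

/-! ### Random access machines with logarithmic cost -/

/-- Programs of a random access machine with registers `r 0, r 1, …` holding natural numbers
and with a read-only input string whose bits can be accessed at random. -/
inductive Prog : Type
  /-- do nothing -/
  | skip
  /-- `r d := c` -/
  | const (d c : ℕ)
  /-- `r d := r a + r b` -/
  | add (d a b : ℕ)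
  /-- `r d := max (r a - r b) 0` -/
  | sub (d a b : ℕ)
  /-- `r d := ⌊r a / 2⌋` -/
  | half (d a : ℕ)
  /-- `r d := r (r a)` -/
  | load (d a : ℕ)
  /-- `r (r a) := r b` -/
  | store (a b : ℕ)
  /-- `r d :=` the input bit at position `r a` (counted from `0`; it is `0` past the end) -/
  | read (d a : ℕ)
  /-- first `p`, then `q` -/
  | seq (p q : Prog)
  /-- if `r a ≠ 0` then `p` else `q` -/
  | ite (a : ℕ) (p q : Prog)
  /-- while `r a ≠ 0` do `p` -/
  | loop (a : ℕ) (p : Prog)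

/-- `Exec w p r r' t`: on the input string `w`, the program `p` started with register contents
`r` halts with register contents `r'` after time `t`. Time is logarithmic cost: an instruction
costs one plus the bit lengths of the numbers and indirect addresses it handles. -/
inductive Exec (w : List Bool) : Prog → (ℕ → ℕ) → (ℕ → ℕ) → ℕ → Prop
  | skip (r : ℕ → ℕ) : Exec w .skip r r 1
  | const (d c : ℕ) (r : ℕ → ℕ) :
      Exec w (.const d c) r (Function.update r d c) (1 + c.size)
  | add (d a b : ℕ) (r : ℕ → ℕ) :
      Exec w (.add d a b) r (Function.update r d (r a + r b)) (1 + (r a).size + (r b).size)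
  | sub (d a b : ℕ) (r : ℕ → ℕ) :
      Exec w (.sub d a b) r (Function.update r d (r a - r b)) (1 + (r a).size + (r b).size)
  | half (d a : ℕ) (r : ℕ → ℕ) :
      Exec w (.half d a) r (Function.update r d (r a / 2)) (1 + (r a).size)
  | load (d a : ℕ) (r : ℕ → ℕ) :
      Exec w (.load d a) r (Function.update r d (r (r a))) (1 + (r a).size + (r (r a)).size)
  | store (a b : ℕ) (r : ℕ → ℕ) :
      Exec w (.store a b) r (Function.update r (r a) (r b)) (1 + (r a).size + (r b).size)
  | read (d a : ℕ) (r : ℕ → ℕ) :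
      Exec w (.read d a) r (Function.update r d (w.getD (r a) false).toNat) (1 + (r a).size)
  | seq {p q : Prog} {r₀ r₁ r₂ : ℕ → ℕ} {t₁ t₂ : ℕ} :
      Exec w p r₀ r₁ t₁ → Exec w q r₁ r₂ t₂ → Exec w (.seq p q) r₀ r₂ (t₁ + t₂)
  | ite_true {a : ℕ} {p q : Prog} {r r' : ℕ → ℕ} {t : ℕ} :
      r a ≠ 0 → Exec w p r r' t → Exec w (.ite a p q) r r' (1 + (r a).size + t)
  | ite_false {a : ℕ} {p q : Prog} {r r' : ℕ → ℕ} {t : ℕ} :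
      r a = 0 → Exec w q r r' t → Exec w (.ite a p q) r r' (1 + t)
  | loop_done {a : ℕ} {p : Prog} {r : ℕ → ℕ} :
      r a = 0 → Exec w (.loop a p) r r 1
  | loop_step {a : ℕ} {p : Prog} {r₀ r₁ r₂ : ℕ → ℕ} {t₁ t₂ : ℕ} :
      r₀ a ≠ 0 → Exec w p r₀ r₁ t₁ → Exec w (.loop a p) r₁ r₂ t₂ →
        Exec w (.loop a p) r₀ r₂ (1 + (r₀ a).size + t₁ + t₂)

/-- On the input string `w`, started with the numbers `args` in the first registers and zero in
all others, `p` halts within time `T` with `v` in register `0`. -/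
def Prog.Outputs (p : Prog) (w : List Bool) (args : List ℕ) (T v : ℕ) : Prop :=
  ∃ (r : ℕ → ℕ) (t : ℕ), Exec w p (fun i => args.getD i 0) r t ∧ t ≤ T ∧ r 0 = v

/-- The number-theoretic function `γ` is computable in time `o(2 ^ n)`, `n` being given in
register `0`. -/
def ComputableInLittleOTwoPow (γ : ℕ → ℕ) : Prop :=
  ∃ (p : Prog) (T : ℕ → ℕ),
    ((fun n => (T n : ℝ)) =o[atTop] fun n => (2 : ℝ) ^ n) ∧
    ∀ n, p.Outputs [] [n] (T n) (γ n)

/-- `NP`: membership `f_n(x) = 1` has certificates of polynomial length, checked by a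
deterministic polynomial time program. The verifier gets the bits of `x` followed by those of
the certificate `y`, and the two lengths. -/
def InNP (f : BoolFunSeq) : Prop :=
  ∃ (p : Prog) (k : ℕ) (R : List Bool → List Bool → Bool),
    ∀ (n : ℕ) (x : Fin n → Bool),
      (∀ y : List Bool, y.length ≤ n ^ k + k →
        p.Outputs (List.ofFn x ++ y) [n, y.length] (n ^ k + k) (R (List.ofFn x) y).toNat) ∧
      (f n x = true ↔ ∃ y : List Bool, y.length ≤ n ^ k + k ∧ R (List.ofFn x) y = true)

/-! ### Natural properties -/

/-- The truth table of `f`, a string of length `2 ^ n`. The entry at position `i` is the value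
of `f` at the input whose `j`-th bit is the `j`-th binary digit of `i` (least significant
digit first). -/
def truthTable {n : ℕ} (f : BoolFun n) : List Bool :=
  List.ofFn fun i : Fin (2 ^ n) => f fun j => (i : ℕ).testBit j

open Classical in
/-- Membership in `C_n` is decidable from the truth table (and its length `N = 2 ^ n`) in time
`o(N)`. -/
def SublinearTimeDecidable (C : Property) : Prop :=
  ∃ (p : Prog) (T : ℕ → ℕ),
    ((fun n => (T n : ℝ)) =o[atTop] fun n => (2 : ℝ) ^ n) ∧
    ∀ (n : ℕ) (f : BoolFun n),
      p.Outputs (truthTable f) [2 ^ n] (T n) (if f ∈ C n then 1 else 0)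

/-- `C` is sublinear-natural with density `δ`. -/
def SublinearNatural (C : Property) (δ : ℕ → ℝ) : Prop :=
  (∀ᶠ n in atTop, (2 : ℝ) ^ (2 ^ n) * δ n ≤ ((C n).ncard : ℝ)) ∧ SublinearTimeDecidable C

/-- No sequence that lies in `C` for infinitely many `n` belongs to `Λ`. -/
def Useful (Λ : BoolFunSeq → Prop) (C : Property) : Prop :=
  ∀ f : BoolFunSeq, (∃ᶠ n in atTop, f n ∈ C n) → ¬ Λ f

/-- No sequence that lies in `C` for all large `n` belongs to `Λ`. -/
def QuasiUseful (Λ : BoolFunSeq → Prop) (C : Property) : Prop :=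
  ∀ f : BoolFunSeq, (∀ᶠ n in atTop, f n ∈ C n) → ¬ Λ f

/-- `C` separates `NP` from `P/poly`: it is quasi-useful against `P/poly`, but contains a
sequence of functions in `NP`. -/
def SeparatesNPFromPPoly (C : Property) : Prop :=
  QuasiUseful InPPoly C ∧ ∃ f : BoolFunSeq, InNP f ∧ ∀ n, f n ∈ C n

/-! ### SAT -/

/-- A literal: the name of a variable (a binary string) and the value that makes the literal
true. -/
abbrev Literal : Type := List Bool × Bool

/-- A formula in conjunctive normal form: a list of clauses, each a list of literals. -/
abbrev CNF : Type := List (List Literal)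

/-- Satisfiability of a formula in conjunctive normal form. -/
def CNF.Satisfiable (φ : CNF) : Prop :=
  ∃ a : List Bool → Bool, ∀ c ∈ φ, ∃ l ∈ c, a l.1 = l.2

/-- A literal is written as its sign followed by the name of its variable, each digit `b` being
doubled to `0b`, followed by the end marker `10`. -/
def encodeLiteral (l : Literal) : List Bool :=
  ((l.2 :: l.1).flatMap fun b => [false, b]) ++ [true, false]

/-- A clause is written as its literals, followed by the end marker `11`. -/
def encodeClause (c : List Literal) : List Bool :=
  c.flatMap encodeLiteral ++ [true, true]

/-- A formula is written as its clauses, one after the other. -/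
def CNF.encode (φ : CNF) : List Bool :=
  φ.flatMap encodeClause

/-- The strings that encode satisfiable formulas. A code may be padded with zeros at its end
(no code ends in a zero, so the padding is recognizable). -/
def SATLanguage : Set (List Bool) :=
  {w | ∃ (φ : CNF) (k : ℕ), CNF.Satisfiable φ ∧ w = CNF.encode φ ++ List.replicate k false}

open Classical in
/-- SAT as a sequence of Boolean functions. -/
noncomputable def SAT : BoolFunSeq :=
  fun _ x => decide (List.ofFn x ∈ SATLanguage)

open Classical in
/-- With `m = γ n`: the Boolean functions `f` on `n` variables such that, for every `x` whose last
`n - m` bits are zero, `f x` says whether the first `m` bits of `x` encode a satisfiable formula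
(if `m > n`, whether `x` does). -/
def satProperty (γ : ℕ → ℕ) : Property :=
  fun n => {f | ∀ x : Fin n → Bool, (∀ i : Fin n, γ n ≤ (i : ℕ) → x i = false) →
    f x = decide ((List.ofFn x).take (γ n) ∈ SATLanguage)}

end AlmostNatural

open AlmostNatural

/-!
The property prescribes the values of `f` on the `2 ^ M` inputs that are zero from position `M` on,
where `M = min (μ n) n`, and leaves all other values free; this gives the density.

**Lower bounds.** Setting variables to zero turns a circuit for a member of the property on `n`
variables into one, of the same size, for satisfiability on any `m ≤ M` bits
(`HasCircuitOfSize.SAT_of_mem`). As `M` outstrips `(log n) ^ (1 / ε)`, the bound `2 ^ (M ^ ε)` is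
superpolynomial in `n`, so members with polynomial circuits at infinitely many `n` contradict
hardness at all large lengths. If they exist at all large `n`, choose for each `m` a number `n`
exponential in `m ^ ε` (`exists_index`) to contradict hardness at infinitely many lengths.

**A member in NP.** Satisfiability itself belongs to the property whatever `μ` is, since codes may
be padded with zeros (`SAT_mem_satProperty`). Its certificates mark, at the positions where they
start, literals that meet every clause and do not contradict each other (`inNP_SAT`).

**Deciding the property.** Trying all assignments for all `2 ^ M` codes would not be sublinear.
Instead the truth table is tested for self-reducibility (`satSeq_iff_deleteSyms`): a code is
satisfiable if and only if either its literals are consistent and every clause has one, or some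
literal can be deleted so that the code stays satisfiable. Read as a number, a code decreases when
a literal is deleted, so a table that passes the test at all `X < 2 ^ M` is, by induction, that of
satisfiability (`forall_selfReducesAt_iff`). The test at one `X` takes polynomial time, and
`2 ^ M` times a polynomial is sublinear if `n - M` outstrips `log n`. If `n - γ n` does not, then
`μ n = min (γ n) (n / 2)` is used in place of `γ`.

**Programs.** Both the test and the verifier are first-order statements about positions in a
string. Formulas of this kind (`Fml`) are compiled to programs once and for all, with a polynomial
time bound (`Fml.runs`, `Fml.polyBounded_cost`). The program that computes `γ` may use any
registers, so it is relocated before it is run as a subroutine (`Exec.relocate`).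
-/

namespace AlmostNatural

/-! ### A timed program logic -/

/-- On the input `w`, the program `p` started in `r` halts within time `T` in a state
satisfying `Q`. -/
def Runs (w : List Bool) (p : Prog) (r : ℕ → ℕ) (T : ℕ) (Q : (ℕ → ℕ) → Prop) : Prop :=
  ∃ r' t, Exec w p r r' t ∧ t ≤ T ∧ Q r'

namespace Runs

variable {w : List Bool} {p q : Prog} {r : ℕ → ℕ} {T T' : ℕ} {Q Q' : (ℕ → ℕ) → Prop}

theorem mono (h : Runs w p r T Q) (hT : T ≤ T') (hQ : ∀ r', Q r' → Q' r') :
    Runs w p r T' Q' := by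
  obtain ⟨r', t, he, ht, hq⟩ := h
  exact ⟨r', t, he, ht.trans hT, hQ _ hq⟩

theorem seq {T₁ T₂ : ℕ} (h : Runs w p r T₁ fun r₁ => Runs w q r₁ T₂ Q) :
    Runs w (.seq p q) r (T₁ + T₂) Q := by
  obtain ⟨r₁, t₁, he, ht, r₂, t₂, he', ht', hq⟩ := h
  exact ⟨r₂, t₁ + t₂, he.seq he', by omega, hq⟩

theorem skip (h : Q r) : Runs w .skip r 1 Q := ⟨r, 1, .skip r, le_rfl, h⟩

theorem const {d c : ℕ} (h : Q (Function.update r d c)) :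
    Runs w (.const d c) r (1 + c.size) Q := ⟨_, _, .const d c r, le_rfl, h⟩

theorem add {d a b S₁ S₂ : ℕ} (ha : (r a).size ≤ S₁) (hb : (r b).size ≤ S₂)
    (h : Q (Function.update r d (r a + r b))) :
    Runs w (.add d a b) r (1 + S₁ + S₂) Q := ⟨_, _, .add d a b r, by omega, h⟩

theorem sub {d a b S₁ S₂ : ℕ} (ha : (r a).size ≤ S₁) (hb : (r b).size ≤ S₂)
    (h : Q (Function.update r d (r a - r b))) :
    Runs w (.sub d a b) r (1 + S₁ + S₂) Q := ⟨_, _, .sub d a b r, by omega, h⟩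

theorem half {d a S : ℕ} (ha : (r a).size ≤ S) (h : Q (Function.update r d (r a / 2))) :
    Runs w (.half d a) r (1 + S) Q := ⟨_, _, .half d a r, by omega, h⟩

theorem read {d a S : ℕ} (ha : (r a).size ≤ S)
    (h : Q (Function.update r d (w.getD (r a) false).toNat)) :
    Runs w (.read d a) r (1 + S) Q := ⟨_, _, .read d a r, by omega, h⟩

theorem ite {a S : ℕ} (ha : (r a).size ≤ S) (hp : r a ≠ 0 → Runs w p r T Q)
    (hq : r a = 0 → Runs w q r T Q) : Runs w (.ite a p q) r (1 + S + T) Q := by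
  by_cases h : r a = 0
  · obtain ⟨r', t, he, ht, hQ⟩ := hq h
    exact ⟨r', _, .ite_false h he, by omega, hQ⟩
  · obtain ⟨r', t, he, ht, hQ⟩ := hp h
    exact ⟨r', _, .ite_true h he, by omega, hQ⟩

/-- A loop whose invariant `I k` counts the `k` rounds that are left. -/
theorem loop {a S : ℕ} {I : ℕ → (ℕ → ℕ) → Prop}
    (hstep : ∀ k r, I (k + 1) r → r a ≠ 0 ∧ (r a).size ≤ S ∧ Runs w p r T (I k))
    (hdone : ∀ r, I 0 r → r a = 0 ∧ Q r) (k : ℕ) (h : I k r) :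
    Runs w (.loop a p) r (k * (1 + S + T) + 1) Q := by
  induction k generalizing r with
  | zero => exact ⟨r, 1, .loop_done (hdone r h).1, by omega, (hdone r h).2⟩
  | succ k ih =>
    obtain ⟨h0, hS, r₁, t₁, he, ht, hI⟩ := hstep k r h
    obtain ⟨r₂, t₂, he', ht', hQ⟩ := ih hI
    refine ⟨r₂, _, .loop_step h0 he he', ?_, hQ⟩
    have : (k + 1) * (1 + S + T) = k * (1 + S + T) + (1 + S + T) := by ring
    omega

end Runs

/-! ### Bit lengths -/

theorem size_le_self (n : ℕ) : n.size ≤ n := Nat.size_le.2 Nat.lt_two_pow_self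

theorem size_add_le (a b : ℕ) : (a + b).size ≤ a.size + b.size := by
  rw [Nat.size_le, pow_add]
  have ha := Nat.lt_size_self a
  have hb := Nat.lt_size_self b
  nlinarith

theorem size_mul_two_pow_le (a k : ℕ) : (a * 2 ^ k).size ≤ a.size + k := by
  rw [Nat.size_le, pow_add]
  exact Nat.mul_lt_mul_of_pos_right (Nat.lt_size_self a) (by positivity)

theorem size_toNat_le (b : Bool) : b.toNat.size ≤ 1 := by cases b <;> simp

/-! ### Relocation of programs -/

/-- The program `p` with its register `i` moved to `i + Z`, behaving as if the input were empty:
every input bit is read as zero. Register `0` is used to compute the relocated indirect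
addresses. -/
def Prog.relocate (Z : ℕ) : Prog → Prog
  | .skip => .skip
  | .const d c => .const (d + Z) c
  | .add d a b => .add (d + Z) (a + Z) (b + Z)
  | .sub d a b => .sub (d + Z) (a + Z) (b + Z)
  | .half d a => .half (d + Z) (a + Z)
  | .load d a => .seq (.const 0 Z) (.seq (.add 0 (a + Z) 0) (.load (d + Z) 0))
  | .store a b => .seq (.const 0 Z) (.seq (.add 0 (a + Z) 0) (.store 0 (b + Z)))
  | .read d _ => .const (d + Z) 0
  | .seq p q => .seq (p.relocate Z) (q.relocate Z)
  | .ite a p q => .ite (a + Z) (p.relocate Z) (q.relocate Z)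
  | .loop a p => .loop (a + Z) (p.relocate Z)

theorem update_relocate {r R : ℕ → ℕ} {Z d c : ℕ} (h : ∀ i, R (i + Z) = r i) (i : ℕ) :
    Function.update R (d + Z) c (i + Z) = Function.update r d c i := by
  simp [Function.update_apply, h]

/-- A relocated program simulates, on any input, the original one on the empty input, with constant
overhead, and leaves the registers `1, …, Z - 1` alone. -/
theorem Exec.relocate {w : List Bool} {Z : ℕ} (hZ : 0 < Z) {p : Prog} {r r' : ℕ → ℕ} {t : ℕ}
    (he : Exec [] p r r' t) (R : ℕ → ℕ) (hR : ∀ i, R (i + Z) = r i) :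
    ∃ R' t', Exec w (p.relocate Z) R R' t' ∧ t' ≤ (4 + 3 * Z) * t ∧
      (∀ i, R' (i + Z) = r' i) ∧ ∀ i, 0 < i → i < Z → R' i = R i := by
  have hZs := size_le_self Z
  induction he generalizing R with
  | skip r => exact ⟨R, 1, .skip R, by nlinarith, hR, fun _ _ _ => rfl⟩
  | const d c r =>
    refine ⟨_, _, .const _ _ R, by nlinarith, update_relocate hR, fun i _ hi => ?_⟩
    exact Function.update_of_ne (by omega) _ _
  | add d a b r =>
    refine ⟨_, _, .add _ _ _ R, ?_, ?_, fun i _ hi => Function.update_of_ne (by omega) _ _⟩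
    · rw [hR, hR]; nlinarith
    · rw [hR, hR]; exact update_relocate hR
  | sub d a b r =>
    refine ⟨_, _, .sub _ _ _ R, ?_, ?_, fun i _ hi => Function.update_of_ne (by omega) _ _⟩
    · rw [hR, hR]; nlinarith
    · rw [hR, hR]; exact update_relocate hR
  | half d a r =>
    refine ⟨_, _, .half _ _ R, ?_, ?_, fun i _ hi => Function.update_of_ne (by omega) _ _⟩
    · rw [hR]; nlinarith
    · rw [hR]; exact update_relocate hR
  | load d a r =>
    refine ⟨_, _, .seq (.const _ _ R) (.seq (.add _ _ _ _) (.load _ _ _)), ?_, ?_, ?_⟩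
    · have h1 := size_add_le (r a) Z
      simp only [Function.update_self, ne_eq, hZ.ne', Nat.add_eq_zero_iff, and_false,
        not_false_eq_true, Function.update_of_ne, hR]
      nlinarith
    · intro i
      simp only [Function.update_self, ne_eq, hZ.ne', Nat.add_eq_zero_iff, and_false,
        not_false_eq_true, Function.update_of_ne, hR]
      apply update_relocate
      intro i
      rw [Function.update_of_ne (by omega), Function.update_of_ne (by omega), hR]
    · intro i h0 hi
      rw [Function.update_of_ne (by omega), Function.update_of_ne (by omega),
        Function.update_of_ne (by omega)]
  | store a b r =>
    refine ⟨_, _, .seq (.const _ _ R) (.seq (.add _ _ _ _) (.store _ _ _)), ?_, ?_, ?_⟩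
    · have h1 := size_add_le (r a) Z
      simp only [Function.update_self, ne_eq, hZ.ne', Nat.add_eq_zero_iff, and_false,
        not_false_eq_true, Function.update_of_ne, hR]
      nlinarith
    · intro i
      simp only [Function.update_self, ne_eq, hZ.ne', Nat.add_eq_zero_iff, and_false,
        not_false_eq_true, Function.update_of_ne, hR]
      apply update_relocate
      intro i
      rw [Function.update_of_ne (by omega), Function.update_of_ne (by omega), hR]
    · intro i h0 hi
      simp only [Function.update_self, ne_eq, hZ.ne', Nat.add_eq_zero_iff, and_false,
        not_false_eq_true, Function.update_of_ne, hR]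
      rw [Function.update_of_ne (by omega), Function.update_of_ne (by omega),
        Function.update_of_ne (by omega)]
  | read d a r =>
    refine ⟨_, _, .const _ _ R, ?_, ?_, fun i _ hi => Function.update_of_ne (by omega) _ _⟩
    · simp; nlinarith
    · simpa using update_relocate hR
  | seq _ _ ih₁ ih₂ =>
    obtain ⟨R₁, t₁, he₁, ht₁, h₁, k₁⟩ := ih₁ R hR
    obtain ⟨R₂, t₂, he₂, ht₂, h₂, k₂⟩ := ih₂ R₁ h₁
    exact ⟨R₂, _, .seq he₁ he₂, by nlinarith, h₂,
      fun i h0 hi => (k₂ i h0 hi).trans (k₁ i h0 hi)⟩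
  | ite_true h _ ih =>
    obtain ⟨R₁, t₁, he₁, ht₁, h₁, k₁⟩ := ih R hR
    exact ⟨R₁, _, .ite_true (by rwa [hR]) he₁, by rw [hR]; nlinarith, h₁, k₁⟩
  | ite_false h _ ih =>
    obtain ⟨R₁, t₁, he₁, ht₁, h₁, k₁⟩ := ih R hR
    exact ⟨R₁, _, .ite_false (by rwa [hR]) he₁, by nlinarith, h₁, k₁⟩
  | loop_done h => exact ⟨R, _, .loop_done (by rwa [hR]), by nlinarith, hR, fun _ _ _ => rfl⟩
  | loop_step h _ _ ih₁ ih₂ =>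
    obtain ⟨R₁, t₁, he₁, ht₁, h₁, k₁⟩ := ih₁ R hR
    obtain ⟨R₂, t₂, he₂, ht₂, h₂, k₂⟩ := ih₂ R₁ h₁
    exact ⟨R₂, _, .loop_step (by rwa [hR]) he₁ he₂, by rw [hR]; nlinarith, h₂,
      fun i h0 hi => (k₂ i h0 hi).trans (k₁ i h0 hi)⟩

/-! ### Polynomially bounded functions -/

/-- `f` is bounded by a power of its argument plus two. -/
def PolyBounded (f : ℕ → ℕ) : Prop := ∃ c, ∀ B, f B ≤ (B + 2) ^ c

namespace PolyBounded

variable {f g : ℕ → ℕ}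

theorem const (c : ℕ) : PolyBounded fun _ => c :=
  ⟨c, fun B => Nat.lt_two_pow_self.le.trans (Nat.pow_le_pow_left (by omega) c)⟩

theorem id : PolyBounded fun B => B := ⟨1, fun B => by simp⟩

theorem add (hf : PolyBounded f) (hg : PolyBounded g) : PolyBounded fun B => f B + g B := by
  obtain ⟨a, ha⟩ := hf
  obtain ⟨b, hb⟩ := hg
  refine ⟨max a b + 1, fun B => ?_⟩
  have h1 : (B + 2) ^ a ≤ (B + 2) ^ max a b := Nat.pow_le_pow_right (by omega) (le_max_left _ _)
  have h2 : (B + 2) ^ b ≤ (B + 2) ^ max a b := Nat.pow_le_pow_right (by omega) (le_max_right _ _)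
  have := ha B
  have := hb B
  rw [pow_succ]
  nlinarith

theorem mul (hf : PolyBounded f) (hg : PolyBounded g) : PolyBounded fun B => f B * g B := by
  obtain ⟨a, ha⟩ := hf
  obtain ⟨b, hb⟩ := hg
  exact ⟨a + b, fun B => by rw [pow_add]; exact Nat.mul_le_mul (ha B) (hb B)⟩

end PolyBounded

/-! ### First-order formulas over strings, compiled to programs -/

/-- Terms for positions in a string, over position variables. -/
inductive Pos : Type
  | var (v : ℕ)
  | len
  | const (c : ℕ)
  | add (s t : Pos)

/-- First-order formulas about the string formed by the binary digits of a number and about the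
input string. Quantifiers range over the positions below the length `M`. -/
inductive Fml : Type
  /-- `s ≤ t` -/
  | le (s t : Pos)
  /-- the input bit at `t` is one -/
  | inp (t : Pos)
  /-- the digit at `t` is one -/
  | bit (t : Pos)
  /-- the input bit is one at the address obtained by deleting the digits from `s` to `t` -/
  | look (s t : Pos)
  | not (φ : Fml)
  | and (φ ψ : Fml)
  | ex (v : ℕ) (φ : Fml)

/-- The number left when the binary digits of `X` at the positions `p, …, q - 1` are deleted and
the higher ones are moved down (for `p ≤ q`). -/
def deleteDigits (X p q : ℕ) : ℕ := X - (X / 2 ^ p - X / 2 ^ q) * 2 ^ p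

/-- The value of a position, where `len` denotes `M` and `var v` denotes `e v`. -/
def Pos.eval (M : ℕ) (e : ℕ → ℕ) : Pos → ℕ
  | .var v => e v
  | .len => M
  | .const c => c
  | .add s t => s.eval M e + t.eval M e

/-- Truth of a formula for the input `w` and the number `X`. -/
def Fml.Holds (w : List Bool) (M X : ℕ) : (ℕ → ℕ) → Fml → Prop
  | e, .le s t => s.eval M e ≤ t.eval M e
  | e, .inp t => w.getD (t.eval M e) false = true
  | e, .bit t => X.testBit (t.eval M e) = true
  | e, .look s t => w.getD (deleteDigits X (s.eval M e) (t.eval M e)) false = true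
  | e, .not φ => ¬ φ.Holds w M X e
  | e, .and φ ψ => φ.Holds w M X e ∧ ψ.Holds w M X e
  | e, .ex v φ => ∃ i < M, φ.Holds w M X (Function.update e v i)

/-- All variables are among the first `K`. -/
def Pos.Below (K : ℕ) : Pos → Prop
  | .var v => v < K
  | .len => True
  | .const _ => True
  | .add s t => s.Below K ∧ t.Below K

/-- All variables, free or bound, are among the first `K`. -/
def Fml.Below (K : ℕ) : Fml → Prop
  | .le s t => s.Below K ∧ t.Below K
  | .inp t => t.Below K
  | .bit t => t.Below K
  | .look s t => s.Below K ∧ t.Below K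
  | .not φ => φ.Below K
  | .and φ ψ => φ.Below K ∧ ψ.Below K
  | .ex v φ => v < K ∧ φ.Below K

/-- `r d := r a`, for `d ≠ a` -/
def Prog.copy (d a : ℕ) : Prog := .seq (.const d 0) (.add d a d)

/-- Halves register `x` as often as register `c` says; register `one` holds `1`. -/
def Prog.shr (x c one : ℕ) : Prog := .loop c (.seq (.half x x) (.sub c c one))

/-- Doubles register `x` as often as register `c` says; register `one` holds `1`. -/
def Prog.shl (x c one : ℕ) : Prog := .loop c (.seq (.add x x x) (.sub c c one))

/-- Computes a position into register `d`. Register `0` holds the length, register `v + 2` the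
variable `v`; registers from `d` on are scratch. -/
def Pos.compile : ℕ → Pos → Prog
  | d, .var v => .copy d (v + 2)
  | d, .len => .copy d 0
  | d, .const c => .const d c
  | d, .add s t => .seq (s.compile d) (.seq (t.compile (d + 1)) (.add d d (d + 1)))

/-- Computes the truth value of a formula into register `d`. Register `0` holds the length `M`,
register `1` the number `X`, register `v + 2` the variable `v`; registers from `d` on are
scratch. -/
def Fml.compile : ℕ → Fml → Prog
  | d, .le s t =>
    .seq (s.compile d) (.seq (t.compile (d + 1)) (.seq (.sub d d (d + 1))
      (.ite d (.const d 0) (.const d 1))))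
  | d, .inp t => .seq (t.compile d) (.read d d)
  | d, .bit t =>
    .seq (t.compile d) (.seq (.copy (d + 1) 1) (.seq (.const (d + 2) 1)
      (.seq (.shr (d + 1) d (d + 2)) (.seq (.half d (d + 1)) (.seq (.add d d d)
        (.sub d (d + 1) d))))))
  | d, .look s t =>
    .seq (s.compile d) (.seq (t.compile (d + 1)) (.seq (.const (d + 2) 1)
      (.seq (.copy (d + 3) 1) (.seq (.copy (d + 4) d) (.seq (.shr (d + 3) (d + 4) (d + 2))
        (.seq (.copy (d + 4) 1) (.seq (.shr (d + 4) (d + 1) (d + 2))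
          (.seq (.sub (d + 3) (d + 3) (d + 4)) (.seq (.shl (d + 3) d (d + 2))
            (.seq (.sub d 1 (d + 3)) (.read d d)))))))))))
  | d, .not φ => .seq (φ.compile d) (.ite d (.const d 0) (.const d 1))
  | d, .and φ ψ => .seq (φ.compile d) (.ite d (ψ.compile d) (.const d 0))
  | d, .ex v φ =>
    .seq (.copy d (v + 2)) (.seq (.const (d + 1) 0) (.seq (.copy (v + 2) 0)
      (.seq (.const (d + 2) 1) (.seq
        (.loop (v + 2) (.seq (.sub (v + 2) (v + 2) (d + 2)) (.seq (φ.compile (d + 3))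
          (.ite (d + 3) (.const (d + 1) 1) .skip))))
        (.seq (.copy (v + 2) d) (.copy d (d + 1)))))))

/-- A bound for the value of a position when all variables are at most `B`. -/
def Pos.bound (B : ℕ) : Pos → ℕ
  | .var _ => B
  | .len => B
  | .const c => c
  | .add s t => s.bound B + t.bound B

/-- A bound for the time needed to compute a position. -/
def Pos.cost (B : ℕ) : Pos → ℕ
  | .var _ => 2 + B
  | .len => 2 + B
  | .const c => 1 + c
  | .add s t => s.cost B + t.cost B + 1 + s.bound B + t.bound B

/-- The time of `k` shifts of a number with at most `S` bits. -/
def shiftCost (k S : ℕ) : ℕ := k * (4 + 2 * k + 2 * S) + 1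

/-- A bound for the time needed to evaluate a formula. -/
def Fml.cost (B : ℕ) : Fml → ℕ
  | .le s t => s.cost B + t.cost B + (5 + 2 * s.bound B + t.bound B)
  | .inp t => t.cost B + (1 + t.bound B)
  | .bit t => t.cost B + shiftCost (t.bound B) B + (8 + 7 * B)
  | .look s t => s.cost B + t.cost B + 2 * shiftCost (s.bound B) B +
      shiftCost (s.bound B) (B + s.bound B) +
      shiftCost (t.bound B) B + (13 + 8 * B + 3 * s.bound B)
  | .not φ => φ.cost B + 4
  | .and φ ψ => φ.cost B + ψ.cost B + 3
  | .ex _ φ => B * (10 + 2 * B + φ.cost B) + (20 + 4 * B)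

theorem Pos.polyBounded_bound (t : Pos) : PolyBounded fun B => t.bound B := by
  induction t with
  | var v => exact .id
  | len => exact .id
  | const c => exact .const c
  | add s t hs ht => exact hs.add ht

theorem Pos.polyBounded_cost (t : Pos) : PolyBounded fun B => t.cost B := by
  induction t with
  | var v => exact (PolyBounded.const 2).add .id
  | len => exact (PolyBounded.const 2).add .id
  | const c => exact .const (1 + c)
  | add s t hs ht =>
    exact (((hs.add ht).add (.const 1)).add s.polyBounded_bound).add t.polyBounded_bound

theorem PolyBounded.shiftCost {f g : ℕ → ℕ} (hf : PolyBounded f) (hg : PolyBounded g) :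
    PolyBounded fun B => shiftCost (f B) (g B) :=
  (hf.mul (((PolyBounded.const 4).add ((PolyBounded.const 2).mul hf)).add
    ((PolyBounded.const 2).mul hg))).add (.const 1)

theorem Fml.polyBounded_cost (φ : Fml) : PolyBounded fun B => φ.cost B := by
  induction φ with
  | le s t =>
    exact (s.polyBounded_cost.add t.polyBounded_cost).add
      (((PolyBounded.const 5).add ((PolyBounded.const 2).mul s.polyBounded_bound)).add
        t.polyBounded_bound)
  | inp t => exact t.polyBounded_cost.add ((PolyBounded.const 1).add t.polyBounded_bound)
  | bit t =>
    exact (t.polyBounded_cost.add (t.polyBounded_bound.shiftCost .id)).add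
      ((PolyBounded.const 8).add ((PolyBounded.const 7).mul .id))
  | look s t =>
    exact ((((s.polyBounded_cost.add t.polyBounded_cost).add
      ((PolyBounded.const 2).mul (s.polyBounded_bound.shiftCost .id))).add
      (s.polyBounded_bound.shiftCost (PolyBounded.id.add s.polyBounded_bound))).add
      (t.polyBounded_bound.shiftCost .id)).add
      (((PolyBounded.const 13).add ((PolyBounded.const 8).mul .id)).add
        ((PolyBounded.const 3).mul s.polyBounded_bound))
  | not φ h => exact h.add (.const 4)
  | and φ ψ h h' => exact (h.add h').add (.const 3)
  | ex v φ h =>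
    exact (PolyBounded.id.mul (((PolyBounded.const 10).add ((PolyBounded.const 2).mul .id)).add
      h)).add ((PolyBounded.const 20).add ((PolyBounded.const 4).mul .id))

theorem Pos.eval_le_bound {K B M : ℕ} {e : ℕ → ℕ} (hM : M ≤ B) (he : ∀ v < K, e v ≤ B) (t : Pos)
    (ht : t.Below K) : t.eval M e ≤ t.bound B := by
  induction t with
  | var v => exact he v ht
  | len => exact hM
  | const c => exact le_rfl
  | add s t hs ht' => exact Nat.add_le_add (hs ht.1) (ht' ht.2)

/-- The registers hold the length `M`, the number `X` and the values `e` of the first `K` position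
variables, and all of these are bounded in terms of `B`. -/
structure Loaded (K B M X : ℕ) (e r : ℕ → ℕ) : Prop where
  len : r 0 = M
  num : r 1 = X
  var : ∀ v < K, r (v + 2) = e v
  len_le : M ≤ B
  num_le : X.size ≤ B
  var_le : ∀ v < K, e v ≤ B

theorem Loaded.of_agree {K B M X d : ℕ} {e r r' : ℕ → ℕ} (h : Loaded K B M X e r)
    (hd : K + 2 ≤ d) (ha : ∀ i < d, r' i = r i) : Loaded K B M X e r' where
  len := by rw [ha 0 (by omega), h.len]
  num := by rw [ha 1 (by omega), h.num]
  var v hv := by rw [ha _ (by omega), h.var v hv]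
  len_le := h.len_le
  num_le := h.num_le
  var_le := h.var_le

theorem Runs.copy {w : List Bool} {r : ℕ → ℕ} {Q : (ℕ → ℕ) → Prop} {d a S : ℕ} (hda : a ≠ d)
    (hS : (r a).size ≤ S) (h : Q (Function.update r d (r a))) :
    Runs w (.copy d a) r (2 + S) Q := by
  refine Runs.mono (T := (1 + Nat.size 0) + (1 + S + 0)) ?_ (by simp; omega) fun _ => id
  refine Runs.seq (Runs.const (Runs.add ?_ ?_ ?_))
  · rwa [Function.update_of_ne hda]
  · simp
  · simpa [Function.update_of_ne hda] using h

theorem Runs.shr {w : List Bool} {r : ℕ → ℕ} {Q : (ℕ → ℕ) → Prop} {x c one k S : ℕ}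
    (hxc : x ≠ c) (hxo : one ≠ x) (hco : one ≠ c) (h1 : r one = 1) (hk : r c ≤ k)
    (hS : (r x).size ≤ S)
    (h : Q (Function.update (Function.update r x (r x / 2 ^ r c)) c 0)) :
    Runs w (.shr x c one) r (shiftCost k S) Q := by
  have key : Runs w (.shr x c one) r (r c * (1 + k + (1 + S + (1 + k + 1))) + 1) Q := by
    refine Runs.loop (I := fun j r' => j ≤ r c ∧
      r' = Function.update (Function.update r x (r x / 2 ^ (r c - j))) c j) ?_ ?_ (r c) ?_
    · rintro j r' ⟨hj, rfl⟩
      refine ⟨by simp, by simpa using (size_le_self _).trans (hj.trans hk), ?_⟩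
      refine Runs.seq (Runs.half ?_ (Runs.sub ?_ ?_ ?_))
      · rw [Function.update_of_ne hxc, Function.update_self]
        exact (Nat.size_le_size (Nat.div_le_self _ _)).trans hS
      · rw [Function.update_of_ne hxc.symm, Function.update_self]
        exact (size_le_self _).trans (hj.trans hk)
      · simp [Function.update_of_ne hxo, Function.update_of_ne hco, h1]
      · refine ⟨by omega, ?_⟩
        have e : r c - j = r c - (j + 1) + 1 := by omega
        ext i
        simp only [Function.update_apply]
        rw [e, pow_succ, ← Nat.div_div_eq_div_mul]
        grind
    · rintro r' ⟨-, rfl⟩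
      exact ⟨by simp, by simpa using h⟩
    · simp
  refine key.mono ?_ fun _ => id
  unfold shiftCost
  nlinarith

theorem Runs.shl {w : List Bool} {r : ℕ → ℕ} {Q : (ℕ → ℕ) → Prop} {x c one k S : ℕ}
    (hxc : x ≠ c) (hxo : one ≠ x) (hco : one ≠ c) (h1 : r one = 1) (hk : r c ≤ k)
    (hS : (r x).size + k ≤ S)
    (h : Q (Function.update (Function.update r x (r x * 2 ^ r c)) c 0)) :
    Runs w (.shl x c one) r (shiftCost k S) Q := by
  have key : Runs w (.shl x c one) r (r c * (1 + k + (1 + S + S + (1 + k + 1))) + 1) Q := by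
    refine Runs.loop (I := fun j r' => j ≤ r c ∧
      r' = Function.update (Function.update r x (r x * 2 ^ (r c - j))) c j) ?_ ?_ (r c) ?_
    · rintro j r' ⟨hj, rfl⟩
      have hs : (r x * 2 ^ (r c - (j + 1))).size ≤ S :=
        (size_mul_two_pow_le _ _).trans (by omega)
      refine ⟨by simp, by simpa using (size_le_self _).trans (hj.trans hk), ?_⟩
      refine Runs.seq (Runs.add ?_ ?_ (Runs.sub ?_ ?_ ?_))
      · rwa [Function.update_of_ne hxc, Function.update_self]
      · rwa [Function.update_of_ne hxc, Function.update_self]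
      · rw [Function.update_of_ne hxc.symm, Function.update_self]
        exact (size_le_self _).trans (hj.trans hk)
      · simp [Function.update_of_ne hxo, Function.update_of_ne hco, h1]
      · refine ⟨by omega, ?_⟩
        have e : r c - j = r c - (j + 1) + 1 := by omega
        ext i
        simp only [Function.update_apply]
        rw [e, pow_succ]
        grind
    · rintro r' ⟨-, rfl⟩
      exact ⟨by simp, by simpa using h⟩
    · simp
  refine key.mono ?_ fun _ => id
  unfold shiftCost
  nlinarith

theorem Pos.runs {w : List Bool} {K B M X : ℕ} {e : ℕ → ℕ} (t : Pos) (ht : t.Below K)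
    {d : ℕ} (hd : K + 2 ≤ d) {r : ℕ → ℕ} (hr : Loaded K B M X e r) {Q : (ℕ → ℕ) → Prop}
    (hQ : ∀ r', (∀ i < d, r' i = r i) → r' d = t.eval M e → Q r') :
    Runs w (t.compile d) r (t.cost B) Q := by
  induction t generalizing d r Q with
  | var v =>
    have hv : v < K := ht
    refine Runs.copy (by omega) ?_ (hQ _ ?_ ?_)
    · rw [hr.var v hv]
      exact (size_le_self _).trans (hr.var_le v hv)
    · intro i hi
      exact Function.update_of_ne (by omega) _ _
    · simpa [Pos.eval] using hr.var v hv
  | len =>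
    refine Runs.copy (by omega) ?_ (hQ _ ?_ ?_)
    · rw [hr.len]
      exact (size_le_self _).trans hr.len_le
    · intro i hi
      exact Function.update_of_ne (by omega) _ _
    · simpa [Pos.eval] using hr.len
  | const c =>
    refine Runs.mono (T := 1 + c.size) (Runs.const (hQ _ ?_ ?_))
      (Nat.add_le_add_left (size_le_self c) 1) fun _ => id
    · intro i hi
      exact Function.update_of_ne (by omega) _ _
    · simp [Pos.eval]
  | add s t hs ht' =>
    refine Runs.mono (T := s.cost B + (t.cost B + (1 + s.bound B + t.bound B))) ?_
      (by simp only [Pos.cost]; omega) fun _ => id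
    refine Runs.seq (hs ht.1 hd hr fun r₁ h₁ v₁ => Runs.seq
      (ht' ht.2 (by omega) (hr.of_agree hd h₁) fun r₂ h₂ v₂ => Runs.add ?_ ?_ (hQ _ ?_ ?_)))
    · rw [h₂ d (by omega), v₁]
      exact (size_le_self _).trans (s.eval_le_bound hr.len_le hr.var_le ht.1)
    · rw [v₂]
      exact (size_le_self _).trans (t.eval_le_bound hr.len_le hr.var_le ht.2)
    · intro i hi
      rw [Function.update_of_ne (by omega), h₂ i (by omega), h₁ i hi]
    · simp [h₂ d (by omega), v₁, v₂, Pos.eval]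

theorem toNat_eq_ite (b : Bool) {_ : Decidable (b = true)} :
    b.toNat = if b = true then 1 else 0 := by
  cases b <;> simp

open Classical in
/-- The compiled program decides the formula, within the time bound and without touching the
registers below `d`. -/
theorem Fml.runs {w : List Bool} {K B M X : ℕ} {e : ℕ → ℕ} (φ : Fml) (hφ : φ.Below K)
    {d : ℕ} (hd : K + 2 ≤ d) {r : ℕ → ℕ} (hr : Loaded K B M X e r) {Q : (ℕ → ℕ) → Prop}
    (hQ : ∀ r', (∀ i < d, r' i = r i) → r' d = (if φ.Holds w M X e then 1 else 0) → Q r') :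
    Runs w (φ.compile d) r (φ.cost B) Q := by
  have sz : ∀ {a b : ℕ}, a ≤ b → a.size ≤ b := fun h => (size_le_self _).trans h
  induction φ generalizing d r e Q with
  | le s t =>
    have hs := s.eval_le_bound hr.len_le hr.var_le hφ.1
    have ht := t.eval_le_bound hr.len_le hr.var_le hφ.2
    refine Runs.mono (T := s.cost B + (t.cost B + ((1 + s.bound B + t.bound B) +
      (1 + s.bound B + 2)))) ?_ (by simp only [Fml.cost]; omega) fun _ => id
    refine Runs.seq (s.runs hφ.1 hd hr fun r₁ h₁ v₁ => Runs.seq (t.runs hφ.2 (by omega)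
      (hr.of_agree hd h₁) fun r₂ h₂ v₂ => Runs.seq (Runs.sub ?_ ?_ (Runs.ite ?_
        (fun h => (Runs.const (hQ _ ?_ ?_)).mono (by simp) fun _ => id)
        (fun h => (Runs.const (hQ _ ?_ ?_)).mono (by simp) fun _ => id)))))
    · rw [h₂ d (by omega), v₁]; exact sz hs
    · rw [v₂]; exact sz ht
    · rw [Function.update_self, h₂ d (by omega), v₁, v₂]
      exact sz ((Nat.sub_le _ _).trans hs)
    · intro i hi
      rw [Function.update_of_ne (by omega), Function.update_of_ne (by omega), h₂ i (by omega),
        h₁ i hi]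
    · rw [Function.update_self, h₂ d (by omega), v₁, v₂] at h
      rw [Function.update_self, if_neg]
      simp only [Fml.Holds]
      omega
    · intro i hi
      rw [Function.update_of_ne (by omega), Function.update_of_ne (by omega), h₂ i (by omega),
        h₁ i hi]
    · rw [Function.update_self, h₂ d (by omega), v₁, v₂] at h
      rw [Function.update_self, if_pos]
      simp only [Fml.Holds]
      omega
  | inp t =>
    have ht := t.eval_le_bound hr.len_le hr.var_le hφ
    refine Runs.seq (t.runs hφ hd hr fun r₁ h₁ v₁ => Runs.read ?_ (hQ _ ?_ ?_))
    · rw [v₁]; exact sz ht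
    · intro i hi
      rw [Function.update_of_ne (by omega), h₁ i hi]
    · rw [Function.update_self, v₁]
      simp only [Fml.Holds]
      exact toNat_eq_ite _
  | bit t =>
    have ht := t.eval_le_bound hr.len_le hr.var_le hφ
    have hX := hr.num_le
    have hX2 : ∀ k, (X / k).size ≤ B := fun k =>
      (Nat.size_le_size (Nat.div_le_self _ _)).trans hX
    refine Runs.mono (T := t.cost B + ((2 + B) + ((1 + Nat.size 1) + (shiftCost (t.bound B) B +
      ((1 + B) + ((1 + B + B) + (1 + B + (B + B)))))))) ?_
      (by simp only [Fml.cost, Nat.size_one]; omega) fun _ => id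
    have d0 : d ≠ 0 := by omega
    have d1 : d ≠ 1 := by omega
    have d1' : 1 ≠ d := by omega
    refine Runs.seq (t.runs hφ hd hr fun r₁ h₁ v₁ => ?_)
    have e1 : r₁ 1 = X := by rw [h₁ 1 (by omega), hr.num]
    refine Runs.seq (Runs.copy (by omega) (by rwa [e1]) ?_)
    refine Runs.seq (Runs.const ?_)
    refine Runs.seq (Runs.shr (by omega) (by omega) (by omega) (by simp) ?_ ?_ ?_)
    · simpa [Function.update_apply, v₁] using ht
    · simpa [Function.update_apply, e1] using hX
    have hh : ((X / 2 ^ t.eval M e) / 2).size ≤ B :=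
      (Nat.size_le_size (Nat.div_le_self _ _)).trans (hX2 _)
    refine Runs.seq (Runs.half ?_ (Runs.seq (Runs.add ?_ ?_ (Runs.sub ?_ ?_ (hQ _ ?_ ?_)))))
    · simpa [Function.update_apply, v₁, e1] using hX2 _
    · simpa [Function.update_apply, v₁, e1] using hh
    · simpa [Function.update_apply, v₁, e1] using hh
    · simpa [Function.update_apply, v₁, e1] using hX2 _
    · simpa [Function.update_apply, v₁, e1] using
        (size_add_le _ _).trans (Nat.add_le_add hh hh)
    · intro i hi
      rw [← h₁ i hi]
      simp [show i ≠ d by omega, show i ≠ d + 1 by omega, show i ≠ d + 2 by omega]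
    · simp only [Function.update_apply, v₁, e1, Fml.Holds, Nat.testBit_eq_decide_div_mod_eq]
      simp
      split_ifs <;> omega
  | look s t =>
    have hs := s.eval_le_bound hr.len_le hr.var_le hφ.1
    have ht := t.eval_le_bound hr.len_le hr.var_le hφ.2
    have hX := hr.num_le
    have hX2 : ∀ k, (X / k).size ≤ B := fun k =>
      (Nat.size_le_size (Nat.div_le_self _ _)).trans hX
    have hX3 : ∀ k l, (X / k - X / l).size ≤ B := fun k l =>
      (Nat.size_le_size (Nat.sub_le _ _)).trans (hX2 k)
    refine Runs.mono (T := s.cost B + (t.cost B + ((1 + Nat.size 1) + ((2 + B) +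
      ((2 + s.bound B) + (shiftCost (s.bound B) B + ((2 + B) + (shiftCost (t.bound B) B +
      ((1 + B + B) + (shiftCost (s.bound B) (B + s.bound B) + ((1 + B + (B + s.bound B)) +
      (1 + B)))))))))))) ?_
      (by simp only [Fml.cost, Nat.size_one]; omega) fun _ => id
    have d0 : d ≠ 0 := by omega
    have d1 : d ≠ 1 := by omega
    have d1' : 1 ≠ d := by omega
    refine Runs.seq (s.runs hφ.1 hd hr fun r₁ h₁ v₁ => Runs.seq (t.runs hφ.2 (by omega)
      (hr.of_agree hd h₁) fun r₂ h₂ v₂ => ?_))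
    have e1 : r₂ 1 = X := by rw [h₂ 1 (by omega), h₁ 1 (by omega), hr.num]
    have e2 : r₂ d = s.eval M e := by rw [h₂ d (by omega), v₁]
    refine Runs.seq (Runs.const ?_)
    refine Runs.seq (Runs.copy (by omega) (by simpa [Function.update_apply, e1] using hX) ?_)
    refine Runs.seq (Runs.copy (by omega) (by simpa [Function.update_apply, e2] using sz hs) ?_)
    refine Runs.seq (Runs.shr (by omega) (by omega) (by omega) (by simp)
      (by simpa [Function.update_apply, e2] using hs)
      (by simpa [Function.update_apply, e1] using hX) ?_)
    refine Runs.seq (Runs.copy (by omega)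
      (by simpa [Function.update_apply, e1] using hX) ?_)
    refine Runs.seq (Runs.shr (by omega) (by omega) (by omega) (by simp)
      (by simpa [Function.update_apply, v₂] using ht)
      (by simpa [Function.update_apply, e1] using hX) ?_)
    refine Runs.seq (Runs.sub
      (by simpa [Function.update_apply, e1, e2, v₂] using hX2 _)
      (by simpa [Function.update_apply, e1, e2, v₂] using hX2 _) ?_)
    refine Runs.seq (Runs.shl (by omega) (by omega) (by omega) (by simp)
      (by simpa [Function.update_apply, e2] using hs)
      (by simpa [Function.update_apply, e1, e2, v₂] using hX3 _ _) ?_)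
    refine Runs.seq (Runs.sub
      (by simpa [Function.update_apply, e1, d0, d1'] using hX)
      (by
        simpa [Function.update_apply, e1, e2, v₂] using
          (size_mul_two_pow_le _ _).trans (Nat.add_le_add (hX3 _ _) hs)) ?_)
    refine Runs.read
      (by
        simpa [Function.update_apply, e1, e2, v₂, d0, d1'] using
          (Nat.size_le_size (Nat.sub_le _ _)).trans hX) (hQ _ ?_ ?_)
    · intro i hi
      rw [← h₁ i hi, ← h₂ i (by omega)]
      simp [Function.update_apply, show i ≠ d by omega, show i ≠ d + 1 by omega,
        show i ≠ d + 2 by omega, show i ≠ d + 3 by omega, show i ≠ d + 4 by omega]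
    · simp only [Fml.Holds, deleteDigits]
      simp only [Function.update_apply, e1, e2, v₂, d1', if_true, if_false]
      simp only [Nat.add_eq_left, Nat.add_left_cancel_iff, Nat.reduceEqDiff, if_false, d0,
        left_eq_add, OfNat.ofNat_ne_zero, one_ne_zero]
      exact toNat_eq_ite _
  | not φ ih =>
    refine Runs.mono (T := φ.cost B + (1 + 1 + 2)) ?_ (by simp only [Fml.cost]; omega)
      fun _ => id
    refine Runs.seq (ih hφ hd hr fun r₁ h₁ v₁ => Runs.ite ?_
        (fun h => (Runs.const (hQ _ ?_ ?_)).mono (by simp) fun _ => id)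
        (fun h => (Runs.const (hQ _ ?_ ?_)).mono (by simp) fun _ => id))
    · rw [v₁]; split_ifs <;> simp
    · intro i hi
      rw [Function.update_of_ne (by omega), h₁ i hi]
    · rw [Function.update_self]
      simp only [Fml.Holds]
      split_ifs at v₁ ⊢ <;> simp_all
    · intro i hi
      rw [Function.update_of_ne (by omega), h₁ i hi]
    · rw [Function.update_self]
      simp only [Fml.Holds]
      split_ifs at v₁ ⊢ <;> simp_all
  | and φ ψ ih ih' =>
    refine Runs.mono (T := φ.cost B + (1 + 1 + (ψ.cost B + 1))) ?_
      (by simp only [Fml.cost]; omega) fun _ => id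
    refine Runs.seq (ih hφ.1 hd hr fun r₁ h₁ v₁ => Runs.ite ?_
        (fun h => (ih' hφ.2 hd (hr.of_agree hd h₁) fun r₂ h₂ v₂ => hQ _ ?_ ?_).mono
          (by simp) fun _ => id)
        (fun h => (Runs.const (hQ _ ?_ ?_)).mono (by simp) fun _ => id))
    · rw [v₁]; split_ifs <;> simp
    · intro i hi
      rw [h₂ i hi, h₁ i hi]
    · rw [v₂]
      have : φ.Holds w M X e := by
        by_contra hc
        exact h (by rw [v₁, if_neg hc])
      simp [Fml.Holds, this]
    · intro i hi
      rw [Function.update_of_ne (by omega), h₁ i hi]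
    · rw [Function.update_self]
      have : ¬ φ.Holds w M X e := by
        intro hc
        rw [v₁, if_pos hc] at h
        omega
      simp [Fml.Holds, this]
  | ex v φ ih =>
    obtain ⟨hv, hφ⟩ := hφ
    have hM := hr.len_le
    have hev := hr.var_le v hv
    refine Runs.mono (T := (2 + B) + ((1 + Nat.size 0) + ((2 + B) + ((1 + Nat.size 1) +
      ((M * (1 + B + ((1 + B + 1) + (φ.cost B + (1 + 1 + 2)))) + 1) +
        ((2 + B) + (2 + 1))))))) ?_ ?_ fun _ => id
    rotate_left
    · have := Nat.mul_le_mul_right (10 + 2 * B + φ.cost B) hM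
      have e : 1 + B + ((1 + B + 1) + (φ.cost B + (1 + 1 + 2))) + 3 = 10 + 2 * B + φ.cost B := by
        omega
      have := Nat.mul_le_mul_left M (show 1 + B + ((1 + B + 1) + (φ.cost B + (1 + 1 + 2))) ≤
        10 + 2 * B + φ.cost B by omega)
      simp only [Fml.cost, Nat.size_zero, Nat.size_one]
      omega
    refine Runs.seq (Runs.copy (by omega) (by rw [hr.var v hv]; exact sz hev) ?_)
    refine Runs.seq (Runs.const ?_)
    refine Runs.seq (Runs.copy (by omega) (S := B) ?_ ?_)
    · simpa [Function.update_apply, show 0 ≠ d by omega, hr.len] using sz hM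
    refine Runs.seq (Runs.const ?_)
    -- the positions from `j` on have been tried, and register `d + 1` says whether one of them
    -- satisfies `φ`
    refine Runs.seq (Runs.loop (I := fun j r' => j ≤ M ∧
      (∀ i < d, i ≠ v + 2 → r' i = r i) ∧ r' (v + 2) = j ∧ r' d = e v ∧ r' (d + 2) = 1 ∧
      r' (d + 1) = if ∃ i < M, j ≤ i ∧ φ.Holds w M X (Function.update e v i) then 1 else 0)
      ?_ ?_ M ?_)
    · rintro j r' ⟨hj, hreg, hcv, hsv, hone, hacc⟩
      refine ⟨by omega, by rw [hcv]; exact sz (by omega), ?_⟩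
      refine Runs.seq (Runs.sub (by rw [hcv]; exact sz (by omega)) (by simp [hone]) ?_)
      rw [hcv, hone]
      refine Runs.seq (ih (e := Function.update e v j) hφ (by omega) ?_ fun r₁ h₁ v₁ =>
        Runs.ite ?_ (fun h => (Runs.const ?_).mono (by simp) fun _ => id)
          (fun h => (Runs.skip ?_).mono (by simp) fun _ => id))
      · refine ⟨?_, ?_, ?_, hM, hr.num_le, ?_⟩
        · rw [Function.update_of_ne (by omega), hreg 0 (by omega) (by omega), hr.len]
        · rw [Function.update_of_ne (by omega), hreg 1 (by omega) (by omega), hr.num]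
        · intro u hu
          by_cases huv : u = v
          · subst huv; simp
          · rw [Function.update_of_ne (by omega), hreg _ (by omega) (by omega),
              Function.update_of_ne huv, hr.var u hu]
        · intro u hu
          by_cases huv : u = v
          · subst huv; simp; omega
          · rw [Function.update_of_ne huv]; exact hr.var_le u hu
      · rw [v₁]; split_ifs <;> simp
      · have hj' : φ.Holds w M X (Function.update e v j) := by
          by_contra hc
          exact h (by rw [v₁, if_neg hc])
        refine ⟨by omega, fun i hi hiv => ?_, ?_, ?_, ?_, ?_⟩
        · rw [Function.update_of_ne (by omega), h₁ i (by omega), Function.update_of_ne hiv,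
            hreg i hi hiv]
        · rw [Function.update_of_ne (by omega), h₁ _ (by omega), Function.update_self]; simp
        · rw [Function.update_of_ne (by omega), h₁ _ (by omega),
            Function.update_of_ne (by omega), hsv]
        · rw [Function.update_of_ne (by omega), h₁ _ (by omega),
            Function.update_of_ne (by omega), hone]
        · rw [Function.update_self, if_pos ⟨j, by omega, le_rfl, hj'⟩]
      · have hj' : ¬ φ.Holds w M X (Function.update e v j) := by
          intro hc
          rw [v₁, if_pos hc] at h
          omega
        refine ⟨by omega, fun i hi hiv => ?_, ?_, ?_, ?_, ?_⟩
        · rw [h₁ i (by omega), Function.update_of_ne hiv, hreg i hi hiv]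
        · rw [h₁ _ (by omega), Function.update_self]; simp
        · rw [h₁ _ (by omega), Function.update_of_ne (by omega), hsv]
        · rw [h₁ _ (by omega), Function.update_of_ne (by omega), hone]
        · rw [h₁ _ (by omega), Function.update_of_ne (by omega), hacc]
          congr 1
          apply propext
          constructor
          · rintro ⟨i, hi, hji, h⟩
            exact ⟨i, hi, by omega, h⟩
          · rintro ⟨i, hi, hji, h⟩
            refine ⟨i, hi, ?_, h⟩
            rcases hji.lt_or_eq with h' | rfl
            · exact h'
            · exact absurd h hj'
    · rintro r' ⟨-, hreg, hcv, hsv, hone, hacc⟩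
      refine ⟨hcv, ?_⟩
      refine Runs.seq (Runs.copy (by omega) (by rw [hsv]; exact sz hev)
        (Runs.copy (by omega) ?_ (hQ _ ?_ ?_)))
      · rw [Function.update_of_ne (by omega), hacc]
        split_ifs <;> simp
      · intro i hi
        by_cases hiv : i = v + 2
        · subst hiv
          rw [Function.update_of_ne (by omega), Function.update_self, hsv, hr.var v hv]
        · rw [Function.update_of_ne (by omega), Function.update_of_ne hiv, hreg i hi hiv]
      · rw [Function.update_self, Function.update_of_ne (by omega), hacc]
        simp only [Nat.zero_le, true_and]
        by_cases hc : (Fml.ex v φ).Holds w M X e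
        · exact (if_pos hc).trans (if_pos hc).symm
        · exact (if_neg hc).trans (if_neg hc).symm
    · refine ⟨le_rfl, fun i hi hiv => ?_, ?_, ?_, ?_, ?_⟩
      · rw [Function.update_of_ne (by omega), Function.update_of_ne hiv,
          Function.update_of_ne (by omega), Function.update_of_ne (by omega)]
      · rw [Function.update_of_ne (by omega), Function.update_self,
          Function.update_of_ne (by omega), Function.update_of_ne (by omega), hr.len]
      · rw [Function.update_of_ne (by omega), Function.update_of_ne (by omega),
          Function.update_of_ne (by omega), Function.update_self, hr.var v hv]
      · rw [Function.update_self]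
      · rw [Function.update_of_ne (by omega), Function.update_of_ne (by omega),
          Function.update_self, if_neg]
        rintro ⟨i, hi, hi', -⟩
        omega

/-! ### Codes as sequences of symbols -/

/-- The tokens of a formula: its literals, and a mark `none` at the end of each clause. -/
abbrev Token : Type := Option Literal

/-- The code of a token, as a list of pairs of bits: `(false, b)` is the digit `b`, while
`(true, false)` ends a literal and `(true, true)` ends a clause. -/
def Token.symbols : Token → List (Bool × Bool)
  | none => [(true, true)]
  | some l => (l.2 :: l.1).map (fun b => (false, b)) ++ [(true, false)]

/-- The tokens of a formula in conjunctive normal form. -/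
def CNF.tokens (φ : CNF) : List Token := φ.flatMap fun c => c.map some ++ [none]

/-- The symbol sequence with the given start, continued by the digit `0`. -/
def seqOf (u : List (Bool × Bool)) (k : ℕ) : Bool × Bool := u.getD k (false, false)

/-- The symbol sequence of a bit sequence. -/
def symAt (b : ℕ → Bool) (k : ℕ) : Bool × Bool := (b (2 * k), b (2 * k + 1))

theorem seqOf_append_add (u v : List (Bool × Bool)) (k : ℕ) :
    seqOf (u ++ v) (u.length + k) = seqOf v k := by
  simp [seqOf, List.getElem?_append_right]

theorem seqOf_append_of_lt {u v : List (Bool × Bool)} {k : ℕ} (h : k < u.length) :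
    seqOf (u ++ v) k = seqOf u k := by
  simp [seqOf, List.getElem?_append_left h]

theorem Token.length_symbols_some (l : Literal) :
    (Token.symbols (some l)).length = l.1.length + 2 := by
  simp [Token.symbols]

/-- A list of tokens that is empty or ends with the end of a clause. -/
def WellEnded (τ : List Token) : Prop := τ = [] ∨ ∃ τ', τ = τ' ++ [none]

theorem WellEnded.cons {t : Token} {τ : List Token} (h : WellEnded τ) (h0 : τ ≠ []) :
    WellEnded (t :: τ) := by
  obtain h | ⟨τ', rfl⟩ := h
  · exact absurd h h0
  · exact Or.inr ⟨t :: τ', rfl⟩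

theorem WellEnded.none_cons {τ : List Token} (h : WellEnded τ) : WellEnded (none :: τ) := by
  obtain rfl | ⟨τ', rfl⟩ := h
  · exact Or.inr ⟨[], rfl⟩
  · exact Or.inr ⟨none :: τ', rfl⟩

theorem WellEnded.erase {τ₁ τ₂ : List Token} {l : Literal} (h : WellEnded (τ₁ ++ some l :: τ₂)) :
    WellEnded (τ₁ ++ τ₂) := by
  obtain h | ⟨τ', h⟩ := h
  · simp at h
  · rcases List.eq_nil_or_concat τ₂ with rfl | ⟨τ₃, t, rfl⟩
    · have := congrArg List.getLast? h
      simp at this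
    · obtain ⟨-, ht⟩ := List.append_inj' (s₁ := τ₁ ++ some l :: τ₃)
        (s₂ := τ') (t₁ := [t]) (t₂ := [none])
        (by simpa using h) rfl
      obtain rfl : t = none := by simpa using ht
      exact Or.inr ⟨τ₁ ++ τ₃, by simp⟩

theorem wellEnded_tokens (φ : CNF) : WellEnded φ.tokens := by
  rcases List.eq_nil_or_concat φ with rfl | ⟨φ', c, rfl⟩
  · exact Or.inl rfl
  · exact Or.inr ⟨CNF.tokens φ' ++ c.map some, by simp [CNF.tokens]⟩

theorem WellEnded.exists_tokens {τ : List Token} (h : WellEnded τ) : ∃ φ : CNF, φ.tokens = τ := by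
  have key : ∀ (τ : List Token) (c : List Literal),
      ∃ φ : CNF, φ.tokens = c.map some ++ τ ++ [none] := by
    intro τ
    induction τ with
    | nil => exact fun c => ⟨[c], by simp [CNF.tokens]⟩
    | cons t τ ih =>
      intro c
      cases t with
      | none =>
        obtain ⟨φ, hφ⟩ := ih []
        exact ⟨c :: φ, by simp [CNF.tokens] at hφ ⊢; rw [hφ]⟩
      | some l =>
        obtain ⟨φ, hφ⟩ := ih (c ++ [l])
        exact ⟨φ, by simpa using hφ⟩
  obtain rfl | ⟨τ', rfl⟩ := h
  · exact ⟨[], rfl⟩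
  · simpa using key τ' []

/-- The clauses formed by the tokens each contain a literal satisfying `P`; the first clause is
also accepted if `acc` holds. -/
def TokSat (P : Literal → Prop) : Prop → List Token → Prop
  | _, [] => True
  | acc, none :: τ => acc ∧ TokSat P False τ
  | acc, some l :: τ => TokSat P (acc ∨ P l) τ

theorem TokSat.mono {P Q : Literal → Prop} (hPQ : ∀ l, P l → Q l) {τ : List Token} {a b : Prop}
    (hab : a → b) (h : TokSat P a τ) : TokSat Q b τ := by
  induction τ generalizing a b with
  | nil => trivial
  | cons t τ ih =>
    cases t with
    | none => exact ⟨hab h.1, ih id h.2⟩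
    | some l => exact ih (Or.imp hab (hPQ l)) h

theorem TokSat.insert {P : Literal → Prop} {τ₁ τ₂ : List Token} {l : Literal} {a : Prop}
    (h : TokSat P a (τ₁ ++ τ₂)) : TokSat P a (τ₁ ++ some l :: τ₂) := by
  induction τ₁ generalizing a with
  | nil => exact TokSat.mono (b := a ∨ P l) (τ := τ₂) (fun _ => id) Or.inl h
  | cons t τ ih =>
    cases t with
    | none => exact ⟨h.1, ih h.2⟩
    | some l => exact ih h

theorem TokSat.erase {P : Literal → Prop} {τ₁ τ₂ : List Token} {l : Literal} (hl : ¬ P l)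
    {a : Prop} (h : TokSat P a (τ₁ ++ some l :: τ₂)) : TokSat P a (τ₁ ++ τ₂) := by
  induction τ₁ generalizing a with
  | nil => exact TokSat.mono (fun _ => id) (fun h => h.resolve_right hl) h
  | cons t τ ih =>
    cases t with
    | none => exact ⟨h.1, ih h.2⟩
    | some l => exact ih h

theorem tokSat_tokens {P : Literal → Prop} (φ : CNF) :
    TokSat P False φ.tokens ↔ ∀ c ∈ φ, ∃ l ∈ c, P l := by
  have clause : ∀ (c : List Literal) (τ : List Token) (a : Prop),
      TokSat P a (c.map some ++ none :: τ) ↔ (a ∨ ∃ l ∈ c, P l) ∧ TokSat P False τ := by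
    intro c τ
    induction c with
    | nil => intro a; simp [TokSat]
    | cons l c ih => intro a; simp [TokSat, ih, or_assoc]
  induction φ with
  | nil => simp [CNF.tokens, TokSat]
  | cons c φ ih =>
    have := clause c (CNF.tokens φ) False
    simp only [CNF.tokens] at ih this
    simp [CNF.tokens, this, ih]

/-- From position `p` on, which is not inside a literal, `s` is the code of `τ`. -/
structure TokensAt (s : ℕ → Bool × Bool) (p : ℕ) (τ : List Token) : Prop where
  seq : ∀ k, s (p + k) = seqOf (τ.flatMap Token.symbols) k
  start : p = 0 ∨ (s (p - 1)).1 = true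

/-- The literal `l` stands in `s` from position `i` to the end mark at position `j`. -/
structure LitAt (s : ℕ → Bool × Bool) (i j : ℕ) (l : Literal) : Prop where
  len : j = i + l.1.length + 1
  sign : s i = (false, l.2)
  name : ∀ k (h : k < l.1.length), s (i + 1 + k) = (false, l.1[k])
  mark : s j = (true, false)
  start : i = 0 ∨ (s (i - 1)).1 = true

theorem LitAt.lt {s : ℕ → Bool × Bool} {i j : ℕ} {l : Literal} (h : LitAt s i j l) : i < j := by
  have := h.len
  omega

theorem LitAt.digit {s : ℕ → Bool × Bool} {i j : ℕ} {l : Literal} (h : LitAt s i j l) {k : ℕ}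
    (hi : i ≤ k) (hj : k < j) : (s k).1 = false := by
  rcases hi.lt_or_eq with hi | rfl
  · have := h.len
    have := h.name (k - i - 1) (by omega)
    rw [show i + 1 + (k - i - 1) = k by omega] at this
    rw [this]
  · rw [h.sign]

theorem LitAt.unique {s : ℕ → Bool × Bool} {i i' j : ℕ} {l l' : Literal} (h : LitAt s i j l)
    (h' : LitAt s i' j l') : i = i' ∧ l = l' := by
  have key : ∀ {i i' : ℕ} {l l' : Literal}, LitAt s i j l → LitAt s i' j l' → ¬ i < i' := by
    intro i i' l l' h h' hi
    have := h.digit (k := i' - 1) (by omega) (by have := h'.lt; omega)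
    rcases h'.start with h0 | h0
    · omega
    · simp [this] at h0
  have hi : i = i' := by
    have := key h h'
    have := key h' h
    omega
  subst hi
  refine ⟨rfl, Prod.ext (List.ext_getElem ?_ fun k hk hk' => ?_) ?_⟩
  · have := h.len
    have := h'.len
    omega
  · have := (h.name k hk).symm.trans (h'.name k hk')
    simpa using this
  · have := h.sign.symm.trans h'.sign
    simpa using this

theorem TokensAt.none_cons {s : ℕ → Bool × Bool} {p : ℕ} {τ : List Token}
    (h : TokensAt s p (none :: τ)) : s p = (true, true) ∧ TokensAt s (p + 1) τ := by
  have h0 : s p = (true, true) := by simpa [seqOf, Token.symbols] using h.seq 0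
  refine ⟨h0, fun k => ?_, Or.inr (by simp [h0])⟩
  rw [add_assoc, h.seq]
  exact seqOf_append_add [(true, true)] _ k

theorem TokensAt.some_cons {s : ℕ → Bool × Bool} {p : ℕ} {l : Literal} {τ : List Token}
    (h : TokensAt s p (some l :: τ)) :
    LitAt s p (p + l.1.length + 1) l ∧ TokensAt s (p + l.1.length + 2) τ := by
  have hs : ∀ k < l.1.length + 2, s (p + k) = seqOf (Token.symbols (some l)) k := by
    intro k hk
    rw [h.seq]
    exact seqOf_append_of_lt (by rwa [Token.length_symbols_some])
  have hE : s (p + l.1.length + 1) = (true, false) := by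
    rw [add_assoc, hs _ (by omega)]
    simp [seqOf, Token.symbols]
  refine ⟨⟨rfl, ?_, fun k hk => ?_, hE, h.start⟩, fun k => ?_, Or.inr (by simp [hE])⟩
  · simpa [seqOf, Token.symbols] using hs 0 (by omega)
  · rw [add_assoc, hs _ (by omega), add_comm 1 k]
    simp [seqOf, Token.symbols, hk, List.getElem?_append_left]
  · rw [add_assoc, add_assoc, h.seq, ← add_assoc, ← Token.length_symbols_some]
    exact seqOf_append_add _ _ k

theorem TokensAt.nil {s : ℕ → Bool × Bool} {p : ℕ} (h : TokensAt s p []) {k : ℕ} (hk : p ≤ k) :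
    s k = (false, false) := by
  have := h.seq (k - p)
  rw [show p + (k - p) = k by omega] at this
  simpa [seqOf] using this

/-- Every literal that stands in the code of a list of tokens is one of the tokens. -/
theorem TokensAt.split {s : ℕ → Bool × Bool} {p : ℕ} {τ : List Token} (h : TokensAt s p τ)
    {i j : ℕ} {l : Literal} (hl : LitAt s i j l) (hp : p ≤ j) :
    ∃ τ₁ τ₂, τ = τ₁ ++ some l :: τ₂ ∧ i = p + (τ₁.flatMap Token.symbols).length := by
  induction τ generalizing p with
  | nil => have := (h.nil hp).symm.trans hl.mark; simp at this
  | cons t τ ih =>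
    cases t with
    | none =>
      obtain ⟨h0, h1⟩ := h.none_cons
      have hpj : p ≠ j := by
        rintro rfl
        have := h0.symm.trans hl.mark
        simp at this
      obtain ⟨τ₁, τ₂, rfl, hi⟩ := ih h1 (by omega)
      exact ⟨none :: τ₁, τ₂, rfl, by simp [hi, Token.symbols]; omega⟩
    | some l' =>
      obtain ⟨h0, h1⟩ := h.some_cons
      by_cases hj : p + l'.1.length + 2 ≤ j
      · obtain ⟨τ₁, τ₂, rfl, hi⟩ := ih h1 hj
        refine ⟨some l' :: τ₁, τ₂, rfl, ?_⟩
        simp only [List.flatMap_cons, List.length_append, Token.length_symbols_some]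
        omega
      · have hj' : j = p + l'.1.length + 1 := by
          by_contra hne
          have := h0.digit hp (by omega)
          simp [hl.mark] at this
        subst hj'
        obtain ⟨rfl, rfl⟩ := hl.unique h0
        exact ⟨[], τ, rfl, by simp⟩

/-- Satisfaction of the clauses, read off from the positions in the code. -/
theorem TokensAt.tokSat_iff {P : Literal → Prop} {s : ℕ → Bool × Bool} {τ : List Token}
    (h : TokensAt s 0 τ) :
    TokSat P False τ ↔ ∀ k, s k = (true, true) → ∃ i j l, LitAt s i j l ∧ P l ∧ j < k ∧
      ∀ t, j ≤ t → t < k → s t ≠ (true, true) := by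
  have key : ∀ (τ : List Token) (p : ℕ) (acc : Prop), TokensAt s p τ →
      (acc ↔ ∃ i j l, LitAt s i j l ∧ P l ∧ j < p ∧ ∀ t, j ≤ t → t < p → s t ≠ (true, true)) →
      (TokSat P acc τ ↔ ∀ k, p ≤ k → s k = (true, true) → ∃ i j l, LitAt s i j l ∧ P l ∧ j < k ∧
        ∀ t, j ≤ t → t < k → s t ≠ (true, true)) := by
    intro τ
    induction τ with
    | nil =>
      intro p acc hτ _
      refine iff_of_true trivial fun k hk hC => ?_
      have := (hτ.nil hk).symm.trans hC
      simp at this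
    | cons t τ ih =>
      intro p acc hτ hacc
      cases t with
      | none =>
        obtain ⟨h0, h1⟩ := hτ.none_cons
        have := ih (p + 1) False h1 (by
          refine iff_of_false id ?_
          rintro ⟨i, j, l, -, -, hj, hC⟩
          exact hC p (by omega) (by omega) h0)
        simp only [TokSat, this, hacc]
        constructor
        · rintro ⟨hp, hk⟩ k hpk hC
          rcases hpk.lt_or_eq with hlt | rfl
          · exact hk k hlt hC
          · exact hp
        · exact fun hk => ⟨hk p le_rfl h0, fun k hpk hC => hk k (by omega) hC⟩
      | some l =>
        obtain ⟨h0, h1⟩ := hτ.some_cons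
        have hno : ∀ t, p ≤ t → t < p + l.1.length + 2 → s t ≠ (true, true) := by
          intro t h1 h2 hC
          by_cases ht : t = p + l.1.length + 1
          · have := h0.mark
            rw [← ht, hC] at this
            simp at this
          · have := h0.digit h1 (by omega)
            simp [hC] at this
        have := ih (p + l.1.length + 2) (acc ∨ P l) h1 (by
          rw [hacc]
          constructor
          · rintro (⟨i, j, l', hl', hP, hj, hC⟩ | hP)
            · refine ⟨i, j, l', hl', hP, by omega, fun t h1 h2 => ?_⟩
              by_cases ht : t < p
              · exact hC t h1 ht
              · exact hno t (by omega) h2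
            · exact ⟨p, _, l, h0, hP, by omega, fun t h1 h2 => hno t (by omega) h2⟩
          · rintro ⟨i, j, l', hl', hP, hj, hC⟩
            by_cases hjp : j < p
            · exact Or.inl ⟨i, j, l', hl', hP, hjp, fun t h1 h2 => hC t h1 (by omega)⟩
            · have hj' : j = p + l.1.length + 1 := by
                by_contra hne
                have := h0.digit (k := j) (by omega) (by omega)
                simp [hl'.mark] at this
              subst hj'
              obtain ⟨rfl, rfl⟩ := hl'.unique h0
              exact Or.inr hP)
        simp only [TokSat, this]
        constructor
        · intro hk k hpk hC
          refine hk k ?_ hC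
          by_contra hlt
          exact hno k hpk (by omega) hC
        · exact fun hk k hpk hC => hk k (by omega) hC
  simpa using key τ 0 False h (by simp)

/-- The local conditions that characterize codes: a literal has a sign, the end of a clause does
not interrupt a literal, and nothing but zeros follows the last clause. -/
def Valid (s : ℕ → Bool × Bool) : Prop :=
  ∀ k, (s k = (true, false) → 0 < k ∧ (s (k - 1)).1 = false) ∧
    (s k = (true, true) → k = 0 ∨ (s (k - 1)).1 = true) ∧
    (s k ≠ (false, false) → ∃ j, k ≤ j ∧ s j = (true, true))

theorem TokensAt.exists_end {s : ℕ → Bool × Bool} {p : ℕ} {τ : List Token} (h : TokensAt s p τ)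
    (hτ : WellEnded τ) (h0 : τ ≠ []) : ∃ j, p ≤ j ∧ s j = (true, true) := by
  obtain h1 | ⟨τ', rfl⟩ := hτ
  · exact absurd h1 h0
  · refine ⟨p + (τ'.flatMap Token.symbols).length, by omega, ?_⟩
    rw [h.seq, List.flatMap_append]
    simp [Token.symbols, seqOf]

theorem TokensAt.valid {s : ℕ → Bool × Bool} {τ : List Token} (h : TokensAt s 0 τ)
    (hτ : WellEnded τ) : Valid s := by
  have key : ∀ (τ : List Token) (p : ℕ), TokensAt s p τ → WellEnded τ → ∀ k, p ≤ k →
      (s k = (true, false) → 0 < k ∧ (s (k - 1)).1 = false) ∧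
      (s k = (true, true) → k = 0 ∨ (s (k - 1)).1 = true) ∧
      (s k ≠ (false, false) → ∃ j, k ≤ j ∧ s j = (true, true)) := by
    intro τ
    induction τ with
    | nil => intro p hp _ k hk; simp [hp.nil hk]
    | cons t τ ih =>
      intro p hp hτ k hk
      have hτ' : WellEnded τ := by
        obtain h1 | ⟨τ', h1⟩ := hτ
        · simp at h1
        · cases τ' with
          | nil => simp at h1; exact Or.inl h1.2
          | cons t' τ' => simp at h1; exact Or.inr ⟨τ', h1.2⟩
      cases t with
      | none =>
        obtain ⟨h0, h1⟩ := hp.none_cons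
        rcases hk.lt_or_eq with hlt | rfl
        · exact ih _ h1 hτ' k hlt
        · simp only [h0, ne_eq, Prod.mk.injEq, Bool.true_eq_false, and_false, false_implies,
            true_and, true_implies, not_false_eq_true]
          exact ⟨hp.start, p, le_rfl, h0⟩
      | some l =>
        obtain ⟨h0, h1⟩ := hp.some_cons
        by_cases hk' : p + l.1.length + 2 ≤ k
        · exact ih _ h1 hτ' k hk'
        · have hend : ∃ j, k ≤ j ∧ s j = (true, true) := by
            have : τ ≠ [] := by
              rintro rfl
              obtain h2 | ⟨τ', h2⟩ := hτ
              · simp at h2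
              · have := congrArg List.getLast? h2
                simp at this
            obtain ⟨j, hj, hC⟩ := h1.exists_end hτ' this
            exact ⟨j, by omega, hC⟩
          by_cases hkE : k = p + l.1.length + 1
          · have hE := h0.mark
            rw [← hkE] at hE
            refine ⟨fun _ => ⟨by omega, h0.digit (by omega) (by omega)⟩, fun hC => ?_,
              fun _ => hend⟩
            simp [hE] at hC
          · have := h0.digit hk (by omega)
            refine ⟨fun hE => ?_, fun hC => ?_, fun _ => hend⟩
            · simp [hE] at this
            · simp [hC] at this
  exact fun k => key τ 0 h hτ k (Nat.zero_le k)

/-- A sequence that satisfies the local conditions can be parsed. -/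
theorem Valid.exists_tokensAt {s : ℕ → Bool × Bool} (hs : Valid s) {m : ℕ}
    (hm : ∀ k, m ≤ k → s k = (false, false)) : ∃ τ, WellEnded τ ∧ TokensAt s 0 τ := by
  have key : ∀ n p, m - p ≤ n → (p = 0 ∨ (s (p - 1)).1 = true) →
      ∃ τ, WellEnded τ ∧ TokensAt s p τ := by
    intro n
    induction n with
    | zero =>
      intro p hp hb
      exact ⟨[], Or.inl rfl, fun k => by simp [seqOf, hm (p + k) (by omega)], hb⟩
    | succ n ih =>
      intro p hp hb
      by_cases hz : ∀ k, p ≤ k → s k = (false, false)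
      · exact ⟨[], Or.inl rfl, fun k => by simp [seqOf, hz (p + k) (by omega)], hb⟩
      · push Not at hz
        obtain ⟨k, hk, hk0⟩ := hz
        obtain ⟨j, hkj, hC⟩ := (hs k).2.2 hk0
        have hpm : p < m := by
          by_contra hpm
          exact hk0 (hm k (by omega))
        by_cases hd : (s p).1 = true
        · -- only the end of a clause can stand here
          have hp2 : s p = (true, true) := by
            by_contra hne
            have hE : s p = (true, false) := by
              ext
              · exact hd
              · by_contra h2
                exact hne (Prod.ext hd (by simpa using h2))
            obtain ⟨h0, h1⟩ := (hs p).1 hE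
            rcases hb with hb | hb
            · omega
            · simp [h1] at hb
          obtain ⟨τ, hτ, hat⟩ := ih (p + 1) (by omega) (Or.inr (by simpa using hd))
          refine ⟨none :: τ, hτ.none_cons, fun k => ?_, hb⟩
          cases k with
          | zero => simpa [seqOf, Token.symbols] using hp2
          | succ k =>
            rw [show p + (k + 1) = p + 1 + k by omega, hat.seq, add_comm k 1]
            exact (seqOf_append_add [(true, true)] _ k).symm
        · -- a literal starts here; its end is the first symbol that is no digit
          have hex : ∃ q, p ≤ q ∧ (s q).1 = true := ⟨j, by omega, by rw [hC]⟩
          obtain ⟨hpq, hq⟩ := Nat.find_spec hex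
          have hmin : ∀ t, p ≤ t → t < Nat.find hex → (s t).1 = false := by
            intro t h1 h2
            have := Nat.find_min hex h2
            simpa [h1] using this
          have hqj : Nat.find hex ≤ j := Nat.find_min' hex ⟨by omega, by rw [hC]⟩
          generalize Nat.find hex = q at hpq hq hmin hqj
          have hpq' : p < q := by
            rcases hpq.lt_or_eq with h | rfl
            · exact h
            · exact absurd hq hd
          have hE : s q = (true, false) := by
            ext
            · exact hq
            · by_contra h2
              have h2' : (s q).2 = true := by simpa using h2
              have hqC : s q = (true, true) := Prod.ext hq h2'
              rcases (hs q).2.1 hqC with h | h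
              · omega
              · rw [hmin (q - 1) (by omega) (by omega)] at h
                simp at h
          obtain ⟨τ, hτ, hat⟩ := ih (q + 1) (by omega) (Or.inr (by simpa using hq))
          let l : Literal := ((List.range (q - p - 1)).map fun t => (s (p + 1 + t)).2, (s p).2)
          have hlen : l.1.length = q - p - 1 := by simp [l]
          refine ⟨some l :: τ, hτ.cons ?_, fun k => ?_, hb⟩
          · rintro rfl
            have hjq : j ≠ q := by
              rintro rfl
              rw [hC] at hE
              simp at hE
            have := (hat.nil (k := j) (by omega)).symm.trans hC
            simp at this
          · by_cases hk : k < q - p + 1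
            · rw [List.flatMap_cons, seqOf_append_of_lt
                (by rw [Token.length_symbols_some, hlen]; omega)]
              rcases Nat.lt_succ_iff_lt_or_eq.1 hk with hk | rfl
              · have hdig := hmin (p + k) (by omega) (by omega)
                cases k with
                | zero => simp [seqOf, Token.symbols, l, Prod.ext_iff] at hdig ⊢; exact hdig
                | succ k =>
                  have hk2 : k < q - p - 1 := by omega
                  simp [seqOf, Token.symbols, l, Prod.ext_iff, hk2,
                    List.getElem?_append_left] at hdig ⊢
                  rw [show p + 1 + k = p + (k + 1) by omega]
                  exact ⟨hdig, rfl⟩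
              · rw [show p + (q - p) = q by omega, hE]
                have : q - p = (((l.2 :: l.1).map fun b => (false, b)).length + 0) := by
                  simp [hlen]; omega
                rw [this, Token.symbols, seqOf_append_add]
                rfl
            · have hk2 : k = (Token.symbols (some l)).length + (k - (q - p + 1)) := by
                rw [Token.length_symbols_some, hlen]; omega
              rw [List.flatMap_cons, hk2, seqOf_append_add, ← hat.seq,
                Token.length_symbols_some, hlen]
              congr 1
              omega
  exact key m 0 (by omega) (Or.inl rfl)

/-! ### Satisfiability in terms of positions -/

/-- The sequence is the code of a satisfiable formula, padded with zeros. -/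
def SatSeq (s : ℕ → Bool × Bool) : Prop :=
  ∃ φ : CNF, φ.Satisfiable ∧ TokensAt s 0 φ.tokens

theorem encode_eq (φ : CNF) :
    φ.encode = (φ.tokens.flatMap Token.symbols).flatMap
        fun p : Bool × Bool => [p.1, p.2] := by
  have lit : ∀ l : Literal,
      encodeLiteral l = (Token.symbols (some l)).flatMap fun p => [p.1, p.2] := by
    intro l
    simp [encodeLiteral, Token.symbols, List.flatMap_map]
  have clause : ∀ c : List Literal, encodeClause c =
      ((c.map some ++ [none]).flatMap Token.symbols).flatMap
        fun p : Bool × Bool => [p.1, p.2] := by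
    intro c
    induction c with
    | nil => simp [encodeClause, Token.symbols]
    | cons l c ih =>
      simp only [encodeClause, List.flatMap_cons, List.append_assoc, List.map_cons,
        List.cons_append, List.flatMap_append, lit] at ih ⊢
      rw [ih]
  induction φ with
  | nil => rfl
  | cons c φ ih =>
    simp only [CNF.encode, CNF.tokens, List.flatMap_cons, List.flatMap_append, clause] at ih ⊢
    rw [ih]

theorem symAt_flatMap (u : List (Bool × Bool)) (k : ℕ) :
    symAt (fun i => (u.flatMap fun p => [p.1, p.2]).getD i false) k = seqOf u k := by
  induction u generalizing k with
  | nil => simp [symAt, seqOf]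
  | cons p u ih =>
    cases k with
    | zero => simp [symAt, seqOf]
    | succ k =>
      have := ih k
      simp only [symAt, seqOf, List.flatMap_cons] at this ⊢
      simpa [show 2 * (k + 1) = 2 * k + 1 + 1 by ring] using this

theorem eq_of_symAt_eq {b b' : ℕ → Bool} (h : symAt b = symAt b') : b = b' := by
  funext i
  have h2 := congrFun h (i / 2)
  simp only [symAt, Prod.mk.injEq] at h2
  rcases Nat.even_or_odd' i with ⟨k, rfl | rfl⟩
  · simpa using h2.1
  · have : (2 * k + 1) / 2 = k := by omega
    rw [this] at h2
    exact h2.2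

/-- Membership in the language depends only on the bits continued by zeros, so not on the amount
of padding. -/
theorem mem_SATLanguage_iff (w : List Bool) :
    w ∈ SATLanguage ↔ SatSeq (symAt fun i => w.getD i false) := by
  constructor
  · rintro ⟨φ, k, hφ, rfl⟩
    refine ⟨φ, hφ, fun k' => ?_, Or.inl rfl⟩
    rw [zero_add, ← symAt_flatMap, ← encode_eq]
    congr 1
    funext i
    simp only [List.getD_eq_getElem?_getD, List.getElem?_append, List.getElem?_replicate]
    split_ifs with h1 h2
    · rfl
    · simp [List.getElem?_eq_none (Nat.le_of_not_lt h1)]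
    · simp [List.getElem?_eq_none (Nat.le_of_not_lt h1)]
  · rintro ⟨φ, hφ, hat⟩
    have hbits : ∀ i, w.getD i false = φ.encode.getD i false := by
      refine congrFun (eq_of_symAt_eq ?_)
      funext k
      have := hat.seq k
      rw [zero_add] at this
      rw [this, ← symAt_flatMap, ← encode_eq]
    -- a nonempty code ends in a one, so it cannot be longer than `w`
    have hlen : φ.encode.length ≤ w.length := by
      obtain h | ⟨τ', h⟩ := wellEnded_tokens φ
      · rw [encode_eq, h]; simp
      · obtain ⟨v, hv⟩ : ∃ v, φ.encode = v ++ [true] := by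
          rw [encode_eq, h]
          exact ⟨(τ'.flatMap Token.symbols).flatMap (fun p : Bool × Bool => [p.1, p.2]) ++ [true],
            by simp [Token.symbols]⟩
        by_contra hlt
        have := hbits v.length
        rw [hv] at this hlt
        simp at this hlt
        rw [List.getElem?_eq_none (by omega)] at this
        simp at this
    refine ⟨φ, w.length - φ.encode.length, hφ, ?_⟩
    refine List.ext_getElem (by simp; omega) fun i h1 h2 => ?_
    have := hbits i
    rw [List.getD_eq_getElem _ _ h1] at this
    rw [this, List.getElem_append]
    split_ifs with h
    · rw [List.getD_eq_getElem _ _ h]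
    · simp [List.getElem?_eq_none (Nat.le_of_not_lt h)]

/-- A literal stands from position `i` to its end mark at position `j`. -/
def Lit (s : ℕ → Bool × Bool) (i j : ℕ) : Prop :=
  i < j ∧ s j = (true, false) ∧ (∀ k, i ≤ k → k < j → (s k).1 = false) ∧
    (i = 0 ∨ (s (i - 1)).1 = true)

/-- The literals from `i` to `j` and from `i'` to `j'` have the same variable. -/
def SameName (s : ℕ → Bool × Bool) (i j i' j' : ℕ) : Prop :=
  j + i' = j' + i ∧ ∀ k, i + 1 + k < j → (s (i + 1 + k)).2 = (s (i' + 1 + k)).2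

/-- The literals that start at the positions in `ch` meet every clause, and no two of them
contradict each other. -/
def Chosen (s : ℕ → Bool × Bool) (ch : ℕ → Prop) : Prop :=
  (∀ k, s k = (true, true) → ∃ i j, Lit s i j ∧ ch i ∧ j < k ∧
    ∀ t, j ≤ t → t < k → s t ≠ (true, true)) ∧
  ∀ i j i' j', Lit s i j → Lit s i' j' → ch i → ch i' → SameName s i j i' j' →
    (s i).2 = (s i').2

theorem lit_iff {s : ℕ → Bool × Bool} {i j : ℕ} : Lit s i j ↔ ∃ l, LitAt s i j l := by
  constructor
  · rintro ⟨hij, hE, hd, hs⟩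
    refine ⟨((List.range (j - i - 1)).map fun t => (s (i + 1 + t)).2, (s i).2), ?_, ?_, ?_, hE, hs⟩
    · simp; omega
    · exact Prod.ext (hd i le_rfl hij) rfl
    · intro k hk
      simp at hk ⊢
      exact Prod.ext (hd _ (by omega) (by omega)) rfl
  · rintro ⟨l, hl⟩
    exact ⟨hl.lt, hl.mark, fun k => hl.digit, hl.start⟩

theorem LitAt.sameName_iff {s : ℕ → Bool × Bool} {i j i' j' : ℕ} {l l' : Literal}
    (h : LitAt s i j l) (h' : LitAt s i' j' l') : SameName s i j i' j' ↔ l.1 = l'.1 := by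
  have e := h.len
  have e' := h'.len
  constructor
  · rintro ⟨h1, h2⟩
    refine List.ext_getElem (by omega) fun k hk hk' => ?_
    have := h2 k (by omega)
    rwa [h.name k hk, h'.name k hk'] at this
  · intro hn
    refine ⟨by rw [hn] at e; omega, fun k hk => ?_⟩
    rw [h.name k (by omega), h'.name k (by rw [← hn]; omega)]
    simp [hn]

theorem LitAt.unique_mark {s : ℕ → Bool × Bool} {i j j' : ℕ} {l l' : Literal}
    (h : LitAt s i j l) (h' : LitAt s i j' l') : j = j' := by
  rcases lt_trichotomy j j' with hlt | heq | hlt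
  · have := h'.digit h.lt.le hlt
    simp [h.mark] at this
  · exact heq
  · have := h.digit h'.lt.le hlt
    simp [h'.mark] at this

theorem satSeq_iff_tokSat {s : ℕ → Bool × Bool} {τ : List Token} (h : TokensAt s 0 τ)
    (hτ : WellEnded τ) :
    SatSeq s ↔ ∃ a : List Bool → Bool, TokSat (fun l => a l.1 = l.2) False τ := by
  constructor
  · rintro ⟨φ, ⟨a, ha⟩, hφ⟩
    exact ⟨a, h.tokSat_iff.2 (hφ.tokSat_iff.1 ((tokSat_tokens φ).2 ha))⟩
  · rintro ⟨a, ha⟩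
    obtain ⟨φ, rfl⟩ := hτ.exists_tokens
    exact ⟨φ, ⟨a, (tokSat_tokens φ).1 ha⟩, h⟩

/-- A consistent choice of literals that meets every clause defines a satisfying assignment. -/
theorem Chosen.satSeq {s : ℕ → Bool × Bool} {τ : List Token} (h : TokensAt s 0 τ)
    (hτ : WellEnded τ) {ch : ℕ → Prop} (hc : Chosen s ch) : SatSeq s := by
  classical
  rw [satSeq_iff_tokSat h hτ]
  refine ⟨fun x => decide (∃ i j, LitAt s i j (x, true) ∧ ch i), ?_⟩
  rw [h.tokSat_iff]
  intro k hk
  obtain ⟨i, j, hl, hi, hjk, hno⟩ := hc.1 k hk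
  obtain ⟨⟨x, b⟩, hl'⟩ := lit_iff.1 hl
  refine ⟨i, j, _, hl', ?_, hjk, hno⟩
  cases b with
  | true => simpa using ⟨i, ⟨j, hl'⟩, hi⟩
  | false =>
    simp only [decide_eq_false_iff_not]
    rintro ⟨i', j', hl₂, hi'⟩
    have := hc.2 i j i' j' hl (lit_iff.2 ⟨_, hl₂⟩) hi hi' ((hl'.sameName_iff hl₂).2 rfl)
    rw [hl'.sign, hl₂.sign] at this
    simp at this

/-- A code is satisfiable if and only if literals can be chosen consistently, meeting every
clause. -/
theorem satSeq_iff_exists_chosen {s : ℕ → Bool × Bool} {m : ℕ}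
    (hm : ∀ k, m ≤ k → s k = (false, false)) : SatSeq s ↔ Valid s ∧ ∃ ch, Chosen s ch := by
  constructor
  · rintro ⟨φ, ⟨a, ha⟩, hφ⟩
    refine ⟨hφ.valid (wellEnded_tokens φ), fun i => ∃ j l, LitAt s i j l ∧ a l.1 = l.2, ?_, ?_⟩
    · intro k hk
      obtain ⟨i, j, l, hl, hal, hjk, hno⟩ := hφ.tokSat_iff.1 ((tokSat_tokens φ).2 ha) k hk
      exact ⟨i, j, lit_iff.2 ⟨l, hl⟩, ⟨j, l, hl, hal⟩, hjk, hno⟩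
    · rintro i j i' j' h h' ⟨j₁, l, hl, hal⟩ ⟨j₂, l', hl', hal'⟩ hn
      obtain ⟨_, h⟩ := lit_iff.1 h
      obtain ⟨_, h'⟩ := lit_iff.1 h'
      obtain rfl := h.unique_mark hl
      obtain rfl := h'.unique_mark hl'
      have := (hl.sameName_iff hl').1 hn
      rw [hl.sign, hl'.sign, ← hal, ← hal', this]
  · rintro ⟨hv, ch, hc⟩
    obtain ⟨τ, hτ, hat⟩ := hv.exists_tokensAt hm
    exact hc.satSeq hat hτ

/-- The sequence left when the symbols from position `i` through `j` are deleted. -/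
def deleteSyms (s : ℕ → Bool × Bool) (i j : ℕ) (k : ℕ) : Bool × Bool :=
  if k < i then s k else s (k + (j + 1 - i))

theorem TokensAt.deleteSyms {s : ℕ → Bool × Bool} {τ₁ τ₂ : List Token} {l : Literal} {i j : ℕ}
    (h : TokensAt s 0 (τ₁ ++ some l :: τ₂)) (hl : LitAt s i j l)
    (hi : i = (τ₁.flatMap Token.symbols).length) :
    TokensAt (deleteSyms s i j) 0 (τ₁ ++ τ₂) := by
  have hj : j + 1 - i = (Token.symbols (some l)).length := by
    rw [Token.length_symbols_some, hl.len]
    omega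
  refine ⟨fun k => ?_, Or.inl rfl⟩
  have hs : ∀ k, s k = _ := fun k => by simpa only [zero_add] using h.seq k
  rw [zero_add, AlmostNatural.deleteSyms, hs, hs, hj, List.flatMap_append, List.flatMap_append,
    List.flatMap_cons]
  split_ifs with hk
  · rw [hi] at hk
    rw [seqOf_append_of_lt hk, seqOf_append_of_lt hk]
  · obtain ⟨k', rfl⟩ := Nat.exists_eq_add_of_le (Nat.le_of_not_lt hk)
    rw [hi, add_assoc, seqOf_append_add, seqOf_append_add, add_comm k', seqOf_append_add]

/-- Self-reducibility. A satisfiable formula either has no false literal under some satisfying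
assignment, and then the set of all its literals is consistent and meets every clause, or it
remains satisfiable when a false literal is deleted. -/
theorem satSeq_iff_deleteSyms {s : ℕ → Bool × Bool} {m : ℕ}
    (hm : ∀ k, m ≤ k → s k = (false, false)) :
    SatSeq s ↔ Valid s ∧ (Chosen s (fun _ => True) ∨
      ∃ i j, Lit s i j ∧ SatSeq (deleteSyms s i j)) := by
  constructor
  · rintro ⟨φ, ⟨a, ha⟩, hφ⟩
    refine ⟨hφ.valid (wellEnded_tokens φ), ?_⟩
    have hsat := (tokSat_tokens φ).2 ha
    by_cases hex : ∃ i j l, LitAt s i j l ∧ a l.1 ≠ l.2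
    · obtain ⟨i, j, l, hl, hal⟩ := hex
      obtain ⟨τ₁, τ₂, hτ, hi⟩ := hφ.split hl (Nat.zero_le j)
      have hw := wellEnded_tokens φ
      rw [hτ] at hφ hsat hw
      rw [zero_add] at hi
      exact Or.inr ⟨i, j, lit_iff.2 ⟨l, hl⟩,
        (satSeq_iff_tokSat (hφ.deleteSyms hl hi) hw.erase).2 ⟨a, hsat.erase hal⟩⟩
    · push Not at hex
      refine Or.inl ⟨fun k hk => ?_, fun i j i' j' h h' _ _ hn => ?_⟩
      · obtain ⟨i, j, l, hl, -, hjk, hno⟩ := hφ.tokSat_iff.1 hsat k hk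
        exact ⟨i, j, lit_iff.2 ⟨l, hl⟩, trivial, hjk, hno⟩
      · obtain ⟨l, hl⟩ := lit_iff.1 h
        obtain ⟨l', hl'⟩ := lit_iff.1 h'
        have := (hl.sameName_iff hl').1 hn
        rw [hl.sign, hl'.sign, ← hex i j l hl, ← hex i' j' l' hl', this]
  · rintro ⟨hv, hc | ⟨i, j, hl, hdel⟩⟩
    · obtain ⟨τ, hτ, hat⟩ := hv.exists_tokensAt hm
      exact hc.satSeq hat hτ
    · obtain ⟨τ, hτ, hat⟩ := hv.exists_tokensAt hm
      obtain ⟨l, hl⟩ := lit_iff.1 hl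
      obtain ⟨τ₁, τ₂, rfl, hi⟩ := hat.split hl (Nat.zero_le j)
      rw [zero_add] at hi
      obtain ⟨a, ha⟩ := (satSeq_iff_tokSat (hat.deleteSyms hl hi) hτ.erase).1 hdel
      exact (satSeq_iff_tokSat hat hτ).2 ⟨a, ha.insert⟩

/-! ### Deletion of binary digits -/

theorem deleteDigits_eq {X p q : ℕ} (hpq : p ≤ q) :
    deleteDigits X p q = X / 2 ^ q * 2 ^ p + X % 2 ^ p := by
  have h1 : X / 2 ^ q ≤ X / 2 ^ p :=
    Nat.div_le_div_left (Nat.pow_le_pow_right (by omega) hpq) (by positivity)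
  have h2 := Nat.div_add_mod' X (2 ^ p)
  have h3 := Nat.mul_le_mul_right (2 ^ p) h1
  rw [deleteDigits, Nat.sub_mul]
  omega

theorem testBit_deleteDigits {X p q : ℕ} (hpq : p ≤ q) (k : ℕ) :
    (deleteDigits X p q).testBit k = if k < p then X.testBit k else X.testBit (k + (q - p)) := by
  rw [deleteDigits_eq hpq, mul_comm,
    Nat.testBit_two_pow_mul_add _ (Nat.mod_lt _ (by positivity))]
  split_ifs with h
  · simp [h]
  · rw [Nat.testBit_div_two_pow]
    congr 1
    omega

theorem symAt_deleteDigits {X i j : ℕ} (hij : i < j) :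
    symAt (deleteDigits X (i + i) (j + j + 2)).testBit = deleteSyms (symAt X.testBit) i j := by
  funext k
  simp only [symAt, deleteSyms, testBit_deleteDigits (show i + i ≤ j + j + 2 by omega)]
  by_cases hk : k < i
  · rw [if_pos (by omega), if_pos (by omega), if_pos hk]
  · rw [if_neg (by omega), if_neg (by omega), if_neg hk]
    congr 2 <;> omega

/-- Deleting a range of digits that contains a one decreases a number. -/
theorem deleteDigits_lt {X p q k : ℕ} (hp : p ≤ k) (hk : k < q) (h : X.testBit k = true) :
    deleteDigits X p q < X := by
  have hX : 2 ^ p ≤ X := (Nat.pow_le_pow_right (by omega) hp).trans (Nat.ge_two_pow_of_testBit h)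
  have h1 : 0 < X / 2 ^ p := Nat.div_pos hX (by positivity)
  have h2 : X / 2 ^ q < X / 2 ^ p := by
    have : 2 ^ q = 2 ^ p * 2 ^ (q - p) := by rw [← pow_add]; congr 1; omega
    rw [this, ← Nat.div_div_eq_div_mul]
    exact Nat.div_lt_self h1 (Nat.one_lt_two_pow (by omega))
  have h3 := Nat.mul_le_mul_right (2 ^ p) (Nat.sub_pos_of_lt h2)
  rw [deleteDigits]
  have : 0 < 2 ^ p := by positivity
  omega

/-! ### The notions for codes as first-order formulas -/

namespace Fml

/-- Implication. -/
def imp (φ ψ : Fml) : Fml := .not (.and φ (.not ψ))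

/-- Disjunction. -/
def or (φ ψ : Fml) : Fml := .not (.and (.not φ) (.not ψ))

/-- Equivalence. -/
def iff (φ ψ : Fml) : Fml := .and (imp φ ψ) (imp ψ φ)

/-- Universal quantification over the positions below the length. -/
def all (v : ℕ) (φ : Fml) : Fml := .not (.ex v (.not φ))

/-- `s < t` -/
def lt (s t : Pos) : Fml := .not (.le t s)

/-- `s = t` -/
def eq (s t : Pos) : Fml := .and (.le s t) (.le t s)

section

variable {w : List Bool} {M X : ℕ} {e : ℕ → ℕ} {φ ψ : Fml} {s t : Pos} {v : ℕ}

@[simp] theorem holds_le : (Fml.le s t).Holds w M X e ↔ s.eval M e ≤ t.eval M e := Iff.rfl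

@[simp] theorem holds_inp : (inp t).Holds w M X e ↔ w.getD (t.eval M e) false = true := Iff.rfl

@[simp] theorem holds_look : (look s t).Holds w M X e ↔
    w.getD (deleteDigits X (s.eval M e) (t.eval M e)) false = true := Iff.rfl

@[simp] theorem holds_not : (Fml.not φ).Holds w M X e ↔ ¬ φ.Holds w M X e := Iff.rfl

@[simp] theorem holds_and :
    (Fml.and φ ψ).Holds w M X e ↔ φ.Holds w M X e ∧ ψ.Holds w M X e := Iff.rfl

@[simp] theorem holds_ex :
    (ex v φ).Holds w M X e ↔ ∃ i < M, φ.Holds w M X (Function.update e v i) := Iff.rfl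

@[simp] theorem holds_imp : (imp φ ψ).Holds w M X e ↔ (φ.Holds w M X e → ψ.Holds w M X e) := by
  simp [imp]

@[simp] theorem holds_or : (or φ ψ).Holds w M X e ↔ φ.Holds w M X e ∨ ψ.Holds w M X e := by
  simp only [or, holds_not, holds_and]
  tauto

@[simp] theorem holds_iff : (iff φ ψ).Holds w M X e ↔ (φ.Holds w M X e ↔ ψ.Holds w M X e) := by
  simp only [iff, holds_and, holds_imp]
  tauto

@[simp] theorem holds_all :
    (all v φ).Holds w M X e ↔ ∀ i < M, φ.Holds w M X (Function.update e v i) := by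
  simp [all]

@[simp] theorem holds_lt : (lt s t).Holds w M X e ↔ s.eval M e < t.eval M e := by simp [lt]

@[simp] theorem holds_eq : (eq s t).Holds w M X e ↔ s.eval M e = t.eval M e := by
  simp only [eq, holds_and, holds_le]
  omega

end

/-- The first bit of the symbol at `t`, where `β` is a formula for the bits. -/
def fst (β : Pos → Fml) (t : Pos) : Fml := β (.add t t)

/-- The second bit of the symbol at `t`. -/
def snd (β : Pos → Fml) (t : Pos) : Fml := β (.add (.add t t) (.const 1))

/-- The symbol at `t` ends a literal. -/
def litEnd (β : Pos → Fml) (t : Pos) : Fml := .and (fst β t) (.not (snd β t))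

/-- The symbol at `t` ends a clause. -/
def clauseEnd (β : Pos → Fml) (t : Pos) : Fml := .and (fst β t) (snd β t)

/-- The position after `t`. -/
abbrev succ (t : Pos) : Pos := .add t (.const 1)

/-- The formula for `Lit`; the variables `i` and `j` must differ from the bound variable `10`. -/
def lit (β : Pos → Fml) (i j : ℕ) : Fml :=
  .and (lt (.var i) (.var j)) (.and (litEnd β (.var j)) (.and
    (all 10 (imp (.le (.var i) (.var 10)) (imp (lt (.var 10) (.var j)) (.not (fst β (.var 10))))))
    (all 10 (imp (eq (succ (.var 10)) (.var i)) (fst β (.var 10))))))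

/-- The formula for `Valid`. -/
def valid (β : Pos → Fml) : Fml :=
  all 4 (.and
    (imp (litEnd β (.var 4)) (.ex 5 (.and (eq (succ (.var 5)) (.var 4)) (.not (fst β (.var 5))))))
    (.and
      (imp (clauseEnd β (.var 4)) (all 5 (imp (eq (succ (.var 5)) (.var 4)) (fst β (.var 5)))))
      (imp (or (fst β (.var 4)) (snd β (.var 4)))
        (.ex 5 (.and (.le (.var 4) (.var 5)) (clauseEnd β (.var 5)))))))

/-- The formula for `SameName`, for the literals from variable `4` to `5` and from `6` to `7`. -/
def sameName (β : Pos → Fml) : Fml :=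
  .and (eq (.add (.var 5) (.var 6)) (.add (.var 7) (.var 4)))
    (all 8 (imp (lt (.add (succ (.var 4)) (.var 8)) (.var 5))
      (iff (snd β (.add (succ (.var 4)) (.var 8))) (snd β (.add (succ (.var 6)) (.var 8))))))

/-- The formula for `Chosen`, where `χ` is a formula for the choice. -/
def chosen (β χ : Pos → Fml) : Fml :=
  .and
    (all 4 (imp (clauseEnd β (.var 4)) (.ex 5 (.ex 6 (.and (lit β 5 6) (.and (χ (.var 5))
      (.and (lt (.var 6) (.var 4)) (all 7 (imp (.le (.var 6) (.var 7))
        (imp (lt (.var 7) (.var 4)) (.not (clauseEnd β (.var 7)))))))))))))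
    (all 4 (all 5 (all 6 (all 7 (imp (lit β 4 5) (imp (lit β 6 7) (imp (χ (.var 4))
      (imp (χ (.var 6)) (imp (sameName β) (iff (snd β (.var 4)) (snd β (.var 6))))))))))))

section

variable {w : List Bool} {M X : ℕ} {β χ : Pos → Fml} {b : ℕ → Bool} {ch : ℕ → Prop} {e : ℕ → ℕ}

theorem holds_fst (hβ : ∀ e t, (β t).Holds w M X e ↔ b (t.eval M e) = true) (t : Pos) :
    (fst β t).Holds w M X e ↔ (symAt b (t.eval M e)).1 = true := by
  simp [fst, hβ, symAt, Pos.eval, two_mul]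

theorem holds_snd (hβ : ∀ e t, (β t).Holds w M X e ↔ b (t.eval M e) = true) (t : Pos) :
    (snd β t).Holds w M X e ↔ (symAt b (t.eval M e)).2 = true := by
  simp [snd, hβ, symAt, Pos.eval, two_mul]

theorem holds_litEnd (hβ : ∀ e t, (β t).Holds w M X e ↔ b (t.eval M e) = true) (t : Pos) :
    (litEnd β t).Holds w M X e ↔ symAt b (t.eval M e) = (true, false) := by
  simp [litEnd, holds_fst hβ, holds_snd hβ, Prod.ext_iff]

theorem holds_clauseEnd (hβ : ∀ e t, (β t).Holds w M X e ↔ b (t.eval M e) = true) (t : Pos) :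
    (clauseEnd β t).Holds w M X e ↔ symAt b (t.eval M e) = (true, true) := by
  simp [clauseEnd, holds_fst hβ, holds_snd hβ, Prod.ext_iff]

theorem symAt_eq_zero (hb : ∀ i, M ≤ i → b i = false) (k : ℕ) (hk : M ≤ k) :
    symAt b k = (false, false) := by
  simp [symAt, hb (2 * k) (by omega), hb (2 * k + 1) (by omega)]

theorem lt_of_symAt_ne (hb : ∀ i, M ≤ i → b i = false) {k : ℕ}
    (h : symAt b k ≠ (false, false)) : k < M := by
  by_contra hk
  exact h (symAt_eq_zero hb k (by omega))

theorem holds_lit (hβ : ∀ e t, (β t).Holds w M X e ↔ b (t.eval M e) = true)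
    (hb : ∀ i, M ≤ i → b i = false) {i j : ℕ} (hi : i ≠ 10) (hj : j ≠ 10) :
    (lit β i j).Holds w M X e ↔ Lit (symAt b) (e i) (e j) := by
  simp only [lit, holds_and, holds_lt, holds_litEnd hβ, holds_all, holds_imp, holds_le, holds_eq,
    holds_not, holds_fst hβ, Pos.eval, Function.update_self, Function.update_of_ne hi,
    Function.update_of_ne hj, Lit, Bool.not_eq_true]
  refine and_congr_right fun hij => and_congr_right fun hE => ?_
  have hjM : e j < M := lt_of_symAt_ne hb (by simp [hE])
  refine and_congr ⟨fun h k h1 h2 => h k (by omega) h1 h2, fun h k _ h1 h2 => h k h1 h2⟩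
    ⟨fun h => ?_, fun h k hk hki => ?_⟩
  · by_cases h0 : e i = 0
    · exact Or.inl h0
    · exact Or.inr (h (e i - 1) (by omega) (by omega))
  · rcases h with h | h
    · omega
    · rwa [← hki] at h

theorem holds_valid (hβ : ∀ e t, (β t).Holds w M X e ↔ b (t.eval M e) = true)
    (hb : ∀ i, M ≤ i → b i = false) : (valid β).Holds w M X e ↔ Valid (symAt b) := by
  have lt_of {k : ℕ} := lt_of_symAt_ne (k := k) hb
  simp only [valid, holds_and, holds_litEnd hβ, holds_clauseEnd hβ, holds_all, holds_ex, holds_imp,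
    holds_le, holds_eq, holds_or, holds_not, holds_fst hβ, holds_snd hβ, Pos.eval,
    Function.update_self, Function.update_of_ne (show (4 : ℕ) ≠ 5 by omega), Valid,
    Bool.not_eq_true]
  have hne : ∀ k, (symAt b k).1 = true ∨ (symAt b k).2 = true ↔ symAt b k ≠ (false, false) := by
    intro k
    rw [Ne, Prod.ext_iff]
    cases (symAt b k).1 <;> cases (symAt b k).2 <;> simp
  constructor
  · intro h k
    refine ⟨fun hE => ?_, fun hC => ?_, fun h0 => ?_⟩
    · obtain ⟨i, -, hi, hd⟩ := (h k (lt_of (by simp [hE]))).1 hE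
      obtain rfl := hi
      exact ⟨by omega, hd⟩
    · by_cases hk : k = 0
      · exact Or.inl hk
      · have hkM : k < M := lt_of (by simp [hC])
        exact Or.inr ((h k hkM).2.1 hC (k - 1) (by omega) (by omega))
    · obtain ⟨i, -, hi⟩ := (h k (lt_of h0)).2.2 ((hne k).2 h0)
      exact ⟨i, hi⟩
  · intro h k hk
    refine ⟨fun hE => ?_, fun hC i _ hi => ?_, fun h0 => ?_⟩
    · obtain ⟨h0, hd⟩ := (h k).1 hE
      exact ⟨k - 1, by omega, by omega, hd⟩
    · rcases (h k).2.1 hC with h' | h'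
      · omega
      · rwa [← hi] at h'
    · obtain ⟨i, hi, hC⟩ := (h k).2.2 ((hne k).1 h0)
      exact ⟨i, lt_of (by simp [hC]), hi, hC⟩

theorem holds_chosen (hβ : ∀ e t, (β t).Holds w M X e ↔ b (t.eval M e) = true)
    (hχ : ∀ e t, (χ t).Holds w M X e ↔ ch (t.eval M e))
    (hb : ∀ i, M ≤ i → b i = false) : (chosen β χ).Holds w M X e ↔ Chosen (symAt b) ch := by
  have lt_of {k : ℕ} := lt_of_symAt_ne (k := k) hb
  have lt_of_lit : ∀ {i j : ℕ}, Lit (symAt b) i j → i < M ∧ j < M := by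
    intro i j h
    have h1 := h.1
    have : j < M := lt_of (by simp [h.2.1])
    omega
  have sn : ∀ e : ℕ → ℕ, e 5 ≤ M →
      ((sameName β).Holds w M X e ↔ SameName (symAt b) (e 4) (e 5) (e 6) (e 7)) := by
    intro e h5
    simp only [sameName, holds_and, holds_eq, holds_all, holds_imp, holds_lt, holds_iff,
      holds_snd hβ, Pos.eval, Function.update_self, SameName, ne_eq,
      Nat.reduceEqDiff, not_false_eq_true, Function.update_of_ne, Bool.coe_iff_coe]
    exact and_congr_right fun _ =>
      ⟨fun h k hk => h k (by omega) hk, fun h k _ hk => h k hk⟩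
  simp only [chosen, holds_and, holds_all, holds_ex, holds_imp, holds_clauseEnd hβ, hχ,
    holds_lt, holds_le, holds_not, holds_iff, holds_snd hβ,
    holds_lit hβ hb (show 4 ≠ 10 by omega) (show 5 ≠ 10 by omega),
    holds_lit hβ hb (show 5 ≠ 10 by omega) (show 6 ≠ 10 by omega),
    holds_lit hβ hb (show 6 ≠ 10 by omega) (show 7 ≠ 10 by omega), Chosen,
    Pos.eval, Function.update_self, ne_eq, Nat.reduceEqDiff,
    not_false_eq_true, Function.update_of_ne, Bool.coe_iff_coe]
  refine and_congr ?_ ?_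
  · constructor
    · intro h k hk
      have hkM : k < M := lt_of (by simp [hk])
      obtain ⟨i, -, j, -, hl, hi, hj, hno⟩ := h k hkM hk
      exact ⟨i, j, hl, hi, hj, fun t h1 h2 => hno t (by omega) h1 h2⟩
    · intro h k _ hk
      obtain ⟨i, j, hl, hi, hj, hno⟩ := h k hk
      exact ⟨i, (lt_of_lit hl).1, j, (lt_of_lit hl).2, hl, hi, hj, fun t _ h1 h2 => hno t h1 h2⟩
  · constructor
    · intro h i j i' j' hl hl' hi hi' hn
      refine h i (lt_of_lit hl).1 j (lt_of_lit hl).2 i' (lt_of_lit hl').1 j' (lt_of_lit hl').2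
        hl hl' hi hi' ?_
      rw [sn _ (by simpa [Function.update_apply] using (lt_of_lit hl).2.le)]
      simpa [Function.update_apply] using hn
    · intro h i _ j hj i' _ j' _ hl hl' hi hi' hn
      refine h i j i' j' hl hl' hi hi' ?_
      rw [sn _ (by simpa [Function.update_apply] using hj.le)] at hn
      simpa [Function.update_apply] using hn

end

/-! ### The formulas for certificates and for self-reducibility -/

/-- The bits of the first `len` positions of the input. -/
def inputBit (t : Pos) : Fml := .and (lt t .len) (.inp t)

/-- The certificate, following the string on the input, chooses literals that show that the
string encodes a satisfiable formula. -/
def verify : Fml := .and (valid inputBit) (chosen inputBit fun t => .inp (.add .len t))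

/-- The entry of the truth table at `X` agrees with the entries at the strings obtained by
deleting a literal from `X`, in the way it must for satisfiability. -/
def selfReduces : Fml :=
  iff (.look (.const 0) (.const 0)) (.and (valid .bit)
    (or (chosen .bit fun _ => .le (.const 0) (.const 0))
      (.ex 4 (.ex 5 (.and (lit .bit 4 5)
        (.look (.add (.var 4) (.var 4)) (.add (.add (.var 5) (.var 5)) (.const 2))))))))

theorem below_verify : verify.Below 12 := by
  simp [verify, valid, chosen, inputBit, lit, litEnd, clauseEnd, sameName, all, imp, or, iff, eq,
    lt, fst, snd, Fml.Below, Pos.Below]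

theorem below_selfReduces : selfReduces.Below 12 := by
  simp [selfReduces, valid, chosen, lit, litEnd, clauseEnd, sameName, all, imp, or, iff, eq,
    lt, fst, snd, Fml.Below, Pos.Below]

theorem holds_verify {n X : ℕ} {l y : List Bool} (hl : l.length = n) {e : ℕ → ℕ} :
    verify.Holds (l ++ y) n X e ↔ Valid (symAt fun i => l.getD i false) ∧
      Chosen (symAt fun i => l.getD i false) fun i => y.getD i false = true := by
  have hβ : ∀ e t, (inputBit t).Holds (l ++ y) n X e ↔ l.getD (t.eval n e) false = true := by
    intro e t
    simp only [inputBit, holds_and, holds_lt, holds_inp, Pos.eval]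
    subst hl
    by_cases h : t.eval l.length e < l.length
    · simp [h, List.getElem?_append_left h]
    · simp [h]
  have hb : ∀ i, n ≤ i → l.getD i false = false := fun i hi => by
    simp [List.getElem?_eq_none (hl ▸ hi)]
  rw [verify, holds_and, holds_valid hβ hb, holds_chosen hβ (ch := fun i => y.getD i false = true)
    ?_ hb]
  intro e t
  simp [Pos.eval, List.getElem?_append_right, ← hl]

theorem holds_selfReduces {w : List Bool} {M X : ℕ} (hX : X < 2 ^ M) {e : ℕ → ℕ} :
    selfReduces.Holds w M X e ↔ (w.getD X false = true ↔ Valid (symAt X.testBit) ∧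
      (Chosen (symAt X.testBit) (fun _ => True) ∨ ∃ i j, Lit (symAt X.testBit) i j ∧
        w.getD (deleteDigits X (i + i) (j + j + 2)) false = true)) := by
  have hβ : ∀ e t, (Fml.bit t).Holds w M X e ↔ X.testBit (t.eval M e) = true := fun _ _ => Iff.rfl
  have hb : ∀ i, M ≤ i → X.testBit i = false := fun i hi =>
    Nat.testBit_lt_two_pow (hX.trans_le (Nat.pow_le_pow_right (by omega) hi))
  rw [selfReduces, holds_iff, holds_and, holds_or, holds_valid hβ hb,
    holds_chosen hβ (ch := fun _ => True) (by simp) hb]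
  simp only [holds_look, Pos.eval, holds_ex, holds_and,
    holds_lit hβ hb (show 4 ≠ 10 by omega) (show 5 ≠ 10 by omega),
    Function.update_self, ne_eq, Nat.reduceEqDiff,
    not_false_eq_true, Function.update_of_ne]
  have h0 : deleteDigits X 0 0 = X := by simp [deleteDigits]
  rw [h0]
  refine iff_congr Iff.rfl (and_congr_right fun _ => or_congr Iff.rfl ?_)
  constructor
  · rintro ⟨i, -, j, -, hl, h⟩
    exact ⟨i, j, hl, h⟩
  · rintro ⟨i, j, hl, h⟩
    have hj : j < M := lt_of_symAt_ne hb (by simp [hl.2.1])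
    exact ⟨i, hl.1.trans hj, j, hj, hl, h⟩

end Fml

/-! ### Satisfiability is in NP -/

theorem SAT_eq_true_iff {n : ℕ} (x : Fin n → Bool) :
    SAT n x = true ↔ SatSeq (symAt fun i => (List.ofFn x).getD i false) := by
  rw [← mem_SATLanguage_iff]
  simp [SAT]

/-- A choice matters only at the positions below `m`, so finitely many certificate bits fix it. -/
theorem chosen_congr {s : ℕ → Bool × Bool} {ch ch' : ℕ → Prop} {m : ℕ}
    (hm : ∀ k, m ≤ k → s k = (false, false)) (h : ∀ i < m, ch i ↔ ch' i) (hc : Chosen s ch) :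
    Chosen s ch' := by
  have lt_of : ∀ {i j}, Lit s i j → i < m := by
    intro i j hl
    by_contra hi
    have := hm j (by have := hl.1; omega)
    simp [hl.2.1] at this
  refine ⟨fun k hk => ?_, fun i j i' j' hl hl' hi hi' hn => ?_⟩
  · obtain ⟨i, j, hl, hi, hj⟩ := hc.1 k hk
    exact ⟨i, j, hl, (h i (lt_of hl)).1 hi, hj⟩
  · exact hc.2 i j i' j' hl hl' ((h i (lt_of hl)).2 hi) ((h i' (lt_of hl')).2 hi') hn

/-- Time bounds in the form that `InNP` asks for. -/
theorem exists_pow_bound {f : ℕ → ℕ} (hf : PolyBounded f) :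
    ∃ k, 1 ≤ k ∧ ∀ n, f n ≤ n ^ k + k := by
  obtain ⟨c, hc⟩ := hf
  have h3 : 0 < 3 ^ c := by positivity
  refine ⟨2 * c + 3 ^ c, by omega, fun n => (hc n).trans ?_⟩
  by_cases hn : n ≤ 1
  · have := Nat.pow_le_pow_left (show n + 2 ≤ 3 by omega) c
    omega
  · calc (n + 2) ^ c ≤ (n ^ 2) ^ c := Nat.pow_le_pow_left (by nlinarith) c
      _ = n ^ (2 * c) := by rw [← pow_mul]
      _ ≤ n ^ (2 * c + 3 ^ c) := Nat.pow_le_pow_right (by omega) (Nat.le_add_right _ _)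
      _ ≤ _ := Nat.le_add_right _ _

open Classical in
/-- The certificate bit at position `i` says whether the literal that starts at symbol `i` is
chosen. -/
theorem inNP_SAT : InNP SAT := by
  obtain ⟨k, hk1, hk⟩ := exists_pow_bound
    (((PolyBounded.const 1).add Fml.verify.polyBounded_cost).add (.const 3))
  refine ⟨.seq (.const 1 0) (.seq (Fml.verify.compile 14) (.copy 0 14)), k,
    fun l y => decide (Fml.verify.Holds (l ++ y) l.length 0 fun _ => 0), fun n x => ⟨?_, ?_⟩⟩
  · intro y hy
    have key : Runs (List.ofFn x ++ y)
        (.seq (.const 1 0) (.seq (Fml.verify.compile 14) (.copy 0 14)))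
        (fun i => [n, y.length].getD i 0) ((1 + Nat.size 0) + (Fml.verify.cost n + (2 + 1)))
        (fun r => r 0 = (decide (Fml.verify.Holds (List.ofFn x ++ y) (List.ofFn x).length 0
          fun _ => 0)).toNat) := by
      refine Runs.seq (Runs.const (Runs.seq (Fml.verify.runs (K := 12) (M := n) (X := 0)
        (e := fun _ => 0) Fml.below_verify (by omega) ?_ fun r' h' v' =>
          Runs.copy (by omega) ?_ ?_)))
      · exact ⟨by simp, by simp, fun v _ => by simp, le_rfl, by simp,
          fun _ _ => Nat.zero_le _⟩
      · rw [v']; split_ifs <;> simp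
      · rw [Function.update_self, v', List.length_ofFn, toNat_eq_ite]
        · simp
        · infer_instance
    obtain ⟨r, t, he, ht, hr⟩ := key
    have := hk n
    simp only [Nat.size_zero] at ht
    exact ⟨r, t, he, by omega, hr⟩
  · rw [SAT_eq_true_iff]
    have hm : ∀ j, n ≤ j → symAt (fun i => (List.ofFn x).getD i false) j = (false, false) :=
      Fml.symAt_eq_zero fun i hi => by simp [hi]
    rw [satSeq_iff_exists_chosen hm]
    simp only [decide_eq_true_iff, Fml.holds_verify]
    constructor
    · rintro ⟨hv, ch, hc⟩
      refine ⟨List.ofFn fun i : Fin n => decide (ch i), ?_, hv, chosen_congr hm ?_ hc⟩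
      · rw [List.length_ofFn]
        exact (Nat.le_self_pow (by omega) n).trans (Nat.le_add_right _ _)
      · intro i hi
        simp [hi]
    · rintro ⟨y, -, hv, hc⟩
      exact ⟨hv, _, hc⟩

/-! ### The property in terms of the truth table -/

theorem getD_truthTable {n : ℕ} (f : BoolFun n) {X : ℕ} (hX : X < 2 ^ n) :
    (truthTable f).getD X false = f fun j => X.testBit j := by
  simp [truthTable, hX]

theorem lt_two_pow_of_testBit {X M : ℕ} (h : ∀ i, M ≤ i → X.testBit i = false) : X < 2 ^ M :=
  Nat.lt_pow_two_of_testBit _ fun i hi => h i hi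

theorem getD_take_ofFn {n m X : ℕ} (hX : X < 2 ^ min m n) (i : ℕ) :
    ((List.ofFn fun j : Fin n => X.testBit j).take m).getD i false = X.testBit i := by
  by_cases hi : i < min m n
  · rw [lt_min_iff] at hi
    simp [hi.1, hi.2]
  · rw [List.getD_eq_getElem?_getD, List.getElem?_eq_none
      (by simp only [List.length_take, List.length_ofFn]; omega)]
    have := Nat.testBit_lt_two_pow
      (hX.trans_le (Nat.pow_le_pow_right (by omega) (Nat.le_of_not_lt hi)))
    simp [this]

/-- The property prescribes the first `2 ^ min (μ n) n` entries of the truth table, and they depend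
only on the digits of their indices. -/
theorem mem_satProperty_iff {μ : ℕ → ℕ} {n : ℕ} (f : BoolFun n) :
    f ∈ satProperty μ n ↔ ∀ X < 2 ^ min (μ n) n,
      ((truthTable f).getD X false = true ↔ SatSeq (symAt X.testBit)) := by
  classical
  have key : ∀ X < 2 ^ min (μ n) n,
      ((List.ofFn fun j : Fin n => X.testBit j).take (μ n) ∈ SATLanguage ↔
        SatSeq (symAt X.testBit)) := by
    intro X hX
    rw [mem_SATLanguage_iff, funext (getD_take_ofFn hX)]
  have hle : ∀ X < 2 ^ min (μ n) n, X < 2 ^ n := fun X hX =>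
    hX.trans_le (Nat.pow_le_pow_right (by omega) (min_le_right _ _))
  simp only [satProperty, Set.mem_ofPred_eq]
  constructor
  · intro h X hX
    rw [getD_truthTable f (hle X hX), h _ ?_, decide_eq_true_iff, key X hX]
    intro i hi
    exact Nat.testBit_lt_two_pow (hX.trans_le
      (Nat.pow_le_pow_right (by omega) ((min_le_left _ _).trans hi)))
  · intro h x hx
    have hbit : (fun j : Fin n => (Nat.ofBits x).testBit j) = x := by
      funext j
      simp
    have hX : Nat.ofBits x < 2 ^ min (μ n) n := by
      refine lt_two_pow_of_testBit fun i hi => ?_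
      by_cases hin : i < n
      · rw [Nat.testBit_ofBits_lt _ _ hin]
        refine hx ⟨i, hin⟩ ?_
        simp only
        omega
      · exact Nat.testBit_ofBits_ge _ _ (by omega)
    have h1 := h _ hX
    rw [getD_truthTable f (hle _ hX), hbit, ← key _ hX, hbit] at h1
    rw [Bool.eq_iff_iff, h1, decide_eq_true_iff]

/-- The condition that `Fml.selfReduces` expresses for the truth table `w`. -/
def SelfReducesAt (w : List Bool) (X : ℕ) : Prop :=
  w.getD X false = true ↔ Valid (symAt X.testBit) ∧
    (Chosen (symAt X.testBit) (fun _ => True) ∨ ∃ i j, Lit (symAt X.testBit) i j ∧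
      w.getD (deleteDigits X (i + i) (j + j + 2)) false = true)

/-- Since the deletion of a literal decreases a number, the local conditions determine the truth
table. -/
theorem forall_selfReducesAt_iff {w : List Bool} {T : ℕ} :
    (∀ X < T, SelfReducesAt w X) ↔
      ∀ X < T, (w.getD X false = true ↔ SatSeq (symAt X.testBit)) := by
  have step : ∀ X, (∀ Y < X, (w.getD Y false = true ↔ SatSeq (symAt Y.testBit))) →
      (SelfReducesAt w X ↔ (w.getD X false = true ↔ SatSeq (symAt X.testBit))) := by
    intro X ih
    have hm : ∀ k, X.size ≤ k → symAt X.testBit k = (false, false) :=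
      Fml.symAt_eq_zero fun i hi => Nat.testBit_lt_two_pow
        ((Nat.lt_size_self X).trans_le (Nat.pow_le_pow_right (by omega) hi))
    rw [SelfReducesAt, satSeq_iff_deleteSyms hm]
    refine iff_congr Iff.rfl (and_congr_right fun _ => or_congr Iff.rfl ?_)
    refine exists_congr fun i => exists_congr fun j => and_congr_right fun hl => ?_
    have hbit : X.testBit (j + j) = true := by
      have := congrArg Prod.fst hl.2.1
      rwa [symAt, two_mul] at this
    have hij := hl.1
    rw [ih _ (deleteDigits_lt (k := j + j) (by omega) (by omega) hbit), symAt_deleteDigits hij]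
  constructor
  · intro h X
    induction X using Nat.strong_induction_on with
    | _ X ih => exact fun hX => (step X fun Y hY => ih Y hY (hY.trans hX)).1 (h X hX)
  · exact fun h X hX => (step X fun Y hY => h Y (hY.trans hX)).2 (h X hX)

/-! ### The sublinear decision procedure -/

/-- The numbers in the registers have at most as many bits as the initial ones and the time spent
allow. -/
theorem Exec.size_le {w : List Bool} {p : Prog} {r r' : ℕ → ℕ} {t : ℕ} (h : Exec w p r r' t)
    {S : ℕ} (hr : ∀ i, (r i).size ≤ S) (i : ℕ) : (r' i).size ≤ S + t := by
  have upd : ∀ {r : ℕ → ℕ} {S t d v : ℕ}, (∀ i, (r i).size ≤ S) → v.size ≤ S + t →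
      ∀ i, (Function.update r d v i).size ≤ S + t := by
    intro r S t d v hr hv i
    rw [Function.update_apply]
    split_ifs
    · exact hv
    · exact (hr i).trans (Nat.le_add_right _ _)
  induction h generalizing S i with
  | skip r => exact (hr i).trans (Nat.le_add_right _ _)
  | const d c r => exact upd hr (by omega) i
  | add d a b r => exact upd hr ((size_add_le _ _).trans (by omega)) i
  | sub d a b r => exact upd hr ((Nat.size_le_size (Nat.sub_le _ _)).trans (by omega)) i
  | half d a r => exact upd hr ((Nat.size_le_size (Nat.div_le_self _ _)).trans (by omega)) i
  | load d a r => exact upd hr (by omega) i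
  | store a b r => exact upd hr (by omega) i
  | read d a r => exact upd hr ((size_toNat_le _).trans (by omega)) i
  | seq _ _ ih ih' => exact (ih' (ih hr) i).trans (by omega)
  | ite_true _ _ ih => exact (ih hr i).trans (by omega)
  | ite_false _ _ ih => exact (ih hr i).trans (by omega)
  | loop_done _ => exact (hr i).trans (Nat.le_add_right _ _)
  | loop_step _ _ _ ih ih' => exact (ih' (ih hr) i).trans (by omega)

/-- Computes the binary logarithm of register `0` into registers `3` and `14`, and `1` into
register `2`. -/
def Prog.logTwo : Prog :=
  .seq (.const 2 1) (.seq (.half 0 0) (.seq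
    (.loop 0 (.seq (.add 3 3 2) (.half 0 0))) (.copy 14 3)))

theorem runs_logTwo (w : List Bool) (n : ℕ) :
    Runs w .logTwo (fun i => [2 ^ n].getD i 0) (n * (3 * n + 7) + (2 * n + 8))
      fun r => r 2 = 1 ∧ r 3 = n ∧ r 14 = n ∧ ∀ i, 0 < i → i ≠ 2 → i ≠ 3 → i ≠ 14 → r i = 0 := by
  have hs : ∀ k, k ≤ n → (2 ^ k).size ≤ n + 1 := fun k hk => by
    rw [Nat.size_pow]
    omega
  have hs2 : ∀ k, k ≤ n → (2 ^ k / 2).size ≤ n + 1 := fun k hk =>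
    (Nat.size_le_size (Nat.div_le_self _ _)).trans (hs k hk)
  refine Runs.mono (T := (1 + Nat.size 1) + ((1 + (n + 1)) +
    ((n * (1 + (n + 1) + ((1 + n + 1) + (1 + (n + 1)))) + 1) + (2 + n)))) ?_ ?_ fun _ => id
  · refine Runs.seq (Runs.const (Runs.seq (Runs.half (by simpa using hs n le_rfl) (Runs.seq
      (Runs.loop (I := fun k r => k ≤ n ∧ r 0 = 2 ^ k / 2 ∧ r 2 = 1 ∧ r 3 = n - k ∧
        ∀ i, 0 < i → i ≠ 2 → i ≠ 3 → r i = 0) ?_ ?_ n ?_)))))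
    · rintro k r ⟨hk, h0, h2, h3, hr⟩
      have h0' : r 0 = 2 ^ k := by rw [h0, pow_succ]; simp
      refine ⟨by rw [h0']; positivity, by rw [h0']; exact hs k (by omega), ?_⟩
      refine Runs.seq (Runs.add ?_ ?_ (Runs.half ?_ ⟨by omega, ?_, ?_, ?_, ?_⟩))
      · rw [h3]; exact (size_le_self _).trans (Nat.sub_le _ _)
      · simp [h2]
      · simpa [h0'] using hs k (by omega)
      · simp [h0']
      · simp [h2]
      · simp [h2, h3]; omega
      · intro i hi hi2 hi3
        rw [Function.update_of_ne (by omega), Function.update_of_ne hi3, hr i hi hi2 hi3]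
    · rintro r ⟨-, h0, h2, h3, hr⟩
      refine ⟨by simp [h0], Runs.copy (by omega) ?_ ⟨?_, ?_, ?_, ?_⟩⟩
      · rw [h3]; exact (size_le_self _).trans (Nat.sub_le _ _)
      · simp [h2]
      · simp [h3]
      · simp [h3]
      · intro i hi hi2 hi3 hi14
        rw [Function.update_of_ne hi14, hr i hi hi2 hi3]
    · refine ⟨le_rfl, by simp, by simp, by simp, fun i hi hi2 hi3 => ?_⟩
      rw [Function.update_of_ne (by omega), Function.update_of_ne hi2]
      obtain ⟨i, rfl⟩ := Nat.exists_eq_add_of_lt hi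
      simp
  · simp only [Nat.size_one]
    have : n * (1 + (n + 1) + ((1 + n + 1) + (1 + (n + 1)))) = n * (3 * n + 7) - n := by
      have : n * (3 * n + 7) = n * (1 + (n + 1) + ((1 + n + 1) + (1 + (n + 1)))) + n := by ring
      omega
    have : n ≤ n * (3 * n + 7) := Nat.le_mul_of_pos_right _ (by omega)
    omega

/-- Computes `M`, the minimum of the output of `p` and register `3` (or half of it) into register
`0`, then `2 ^ M` into register `1`, and `1` into register `5`. -/
def Prog.prepare (p : Prog) (halve : Bool) : Prog :=
  .seq (p.relocate 14) (.seq (if halve then .half 3 3 else .half 4 3) (.seq (.sub 4 14 3)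
    (.seq (.sub 0 14 4) (.seq (.const 1 1) (.seq (.copy 4 0) (.seq (.shl 1 4 2)
      (.const 5 1)))))))

theorem runs_prepare (w : List Bool) {p : Prog} {n T v : ℕ} (halve : Bool)
    (hp : p.Outputs [] [n] T v) {r : ℕ → ℕ} (h2 : r 2 = 1) (h3 : r 3 = n) (h14 : r 14 = n)
    (hr : ∀ i, 0 < i → i ≠ 2 → i ≠ 3 → i ≠ 14 → r i = 0) {M : ℕ}
    (hM : M = min v (if halve then n / 2 else n)) :
    Runs w (.prepare p halve) r (49 * T + (shiftCost n (n + 1) + (6 * n + 10)))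
      fun r => r 0 = M ∧ r 1 = 2 ^ M ∧ r 2 = 1 ∧ r 5 = 1 ∧ ∀ i, 2 ≤ i → i < 14 → r i ≤ n + 1 := by
  obtain ⟨ro, t, he, ht, hv⟩ := hp
  have hsv : v.size ≤ n + T := by
    rw [← hv]
    refine (he.size_le (S := n) (fun i => ?_) 0).trans (by omega)
    rcases i with _ | i
    · exact size_le_self n
    · simp
  obtain ⟨R, t', he', ht', hR, hk⟩ := he.relocate (w := w) (Z := 14) (by omega) r (fun i => by
    rcases i with _ | i
    · simpa using h14
    · simpa using hr (i + 1 + 14) (by omega) (by omega) (by omega) (by omega))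
  have hR14 : R 14 = v := by rw [← hv, ← hR 0]
  have hR2 : R 2 = 1 := by rw [hk 2 (by omega) (by omega), h2]
  have hR3 : R 3 = n := by rw [hk 3 (by omega) (by omega), h3]
  have hR0 : ∀ i, 0 < i → i ≠ 2 → i ≠ 3 → i < 14 → R i = 0 := fun i h h' h'' h3 => by
    rw [hk i h h3, hr i h h' h'' (by omega)]
  set g := if halve then n / 2 else n with hg
  have hgn : g ≤ n := by rw [hg]; split_ifs <;> omega
  have hsn := size_le_self n
  have hsg : g.size ≤ n := (size_le_self g).trans hgn
  have hMn : M ≤ n := by omega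
  -- with truncated subtraction, this is how the machine computes a minimum
  have hMv : v - (v - g) = M := by omega
  have hreloc : Runs w (p.relocate 14) r (46 * T) (fun r' => r' = R) :=
    ⟨R, t', he', ht'.trans (by omega), rfl⟩
  refine Runs.mono (T := 46 * T + ((1 + n) + ((1 + (n + T) + n) + ((1 + (n + T) + (n + T)) +
    ((1 + Nat.size 1) + ((2 + n) + (shiftCost n (n + 1) + (1 + Nat.size 1)))))))) ?_ ?_ fun _ => id
  rotate_left
  · simp only [Nat.size_one]
    omega
  refine Runs.seq (hreloc.mono le_rfl fun r' hr' => ?_)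
  rw [hr']
  have hhalf : Runs w (if halve then Prog.half 3 3 else Prog.half 4 3) R (1 + n) fun r =>
      r 3 = g ∧ r 14 = v ∧ r 2 = 1 ∧ ∀ i, 0 < i → i ≠ 2 → i ≠ 3 → i ≠ 4 → i < 14 → r i = 0 := by
    cases halve with
    | true =>
      refine Runs.half (by rwa [hR3]) ⟨by simp [hR3, hg], by simp [hR14], by simp [hR2], ?_⟩
      intro i hi h2 h3 _ h14
      rw [Function.update_of_ne h3, hR0 i hi h2 h3 h14]
    | false =>
      refine Runs.half (by rwa [hR3]) ⟨by simp [hR3, hg], by simp [hR14], by simp [hR2], ?_⟩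
      intro i hi h2 h3 h4 h14
      rw [Function.update_of_ne h4, hR0 i hi h2 h3 h14]
  refine Runs.seq (hhalf.mono le_rfl ?_)
  rintro r ⟨h3, h14, h2, h0⟩
  refine Runs.seq (Runs.sub (by rwa [h14]) (by rwa [h3]) ?_)
  refine Runs.seq (Runs.sub (by simpa [h14] using hsv)
    (by simpa [h14] using (Nat.size_le_size (Nat.sub_le _ _)).trans hsv) ?_)
  refine Runs.seq (Runs.const (Runs.seq (Runs.copy (by omega) ?_ ?_)))
  · simpa [h14, h3, hMv] using (size_le_self _).trans hMn
  refine Runs.seq (Runs.shl (by omega) (by omega) (by omega) (by simp [h2])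
    (by simpa [h14, h3, hMv] using hMn) (by simp; omega) (Runs.const ?_))
  refine ⟨by simp [h14, h3, hMv], by simp [h14, h3, hMv], by simp [h2], by simp, ?_⟩
  intro i hi hi14
  by_cases i5 : i = 5
  · subst i5; simp
  by_cases i4 : i = 4
  · subst i4; simp
  by_cases i3 : i = 3
  · subst i3
    simp [h3]
    omega
  by_cases i2 : i = 2
  · subst i2; simp [h2]
  have i1 : i ≠ 1 := by omega
  have i0 : i ≠ 0 := by omega
  simp [i5, i4, i1, i0, h0 i (by omega) i2 i3 i4 hi14]

/-- Checks the local conditions for all numbers below the content of register `1`. -/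
def Prog.checkAll : Prog :=
  .seq (.loop 1 (.seq (.sub 1 1 2) (.seq (Fml.selfReduces.compile 14)
    (.ite 14 .skip (.const 5 0))))) (.copy 0 5)

open Classical in
/-- Register `5` keeps the verdict on the numbers already tested, which are those from the
counter in register `1` on. -/
theorem runs_checkAll {w : List Bool} {n M : ℕ} (hMn : M ≤ n) {r : ℕ → ℕ} (h0 : r 0 = M)
    (h1 : r 1 = 2 ^ M) (h2 : r 2 = 1) (h5 : r 5 = 1) (hr : ∀ i, 2 ≤ i → i < 14 → r i ≤ n + 1) :
    Runs w .checkAll r (2 ^ M * (2 * n + 10 + Fml.selfReduces.cost (n + 1)) + 4)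
      fun r => r 0 = if ∀ X < 2 ^ M, SelfReducesAt w X then 1 else 0 := by
  have hsz : ∀ k, k ≤ 2 ^ M → k.size ≤ n + 1 := fun k hk =>
    (Nat.size_le_size hk).trans (by rw [Nat.size_pow]; omega)
  refine Runs.mono (T := (2 ^ M * (1 + (n + 1) + ((1 + (n + 1) + 1) +
    (Fml.selfReduces.cost (n + 1) + (1 + 1 + 1)))) + 1) + (2 + 1)) ?_ ?_ fun _ => id
  · refine Runs.seq (Runs.loop (I := fun k r => k ≤ 2 ^ M ∧ r 1 = k ∧ r 0 = M ∧ r 2 = 1 ∧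
      (r 5 = if ∀ X < 2 ^ M, k ≤ X → SelfReducesAt w X then 1 else 0) ∧
      ∀ i, 2 ≤ i → i < 14 → r i ≤ n + 1) ?_ ?_ (2 ^ M) ?_)
    · rintro k r ⟨hk, h1, h0, h2, h5, hr⟩
      refine ⟨by omega, by rw [h1]; exact hsz _ hk, ?_⟩
      refine Runs.seq (Runs.sub (by rw [h1]; exact hsz _ hk) (by simp [h2]) ?_)
      have h1' : r 1 - r 2 = k := by omega
      rw [h1']
      refine Runs.seq (Fml.selfReduces.runs (K := 12) (M := M) (X := k) (e := fun v => r (v + 2))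
        Fml.below_selfReduces (by omega) ?_ fun r' hr' hv => ?_)
      · refine ⟨by simp [h0], by simp, ?_, by omega, hsz k (by omega), ?_⟩
        · intro v _
          simp
        · intro v hv
          exact hr _ (by omega) (by omega)
      · have e0 : r' 0 = M := by rw [hr' 0 (by omega)]; simp [h0]
        have e1 : r' 1 = k := by rw [hr' 1 (by omega)]; simp
        have er : ∀ i, 2 ≤ i → i < 14 → r' i = r i := fun i hi hi' => by
          rw [hr' i hi', Function.update_of_ne (by omega)]
        have e2 : r' 2 = 1 := by rw [er 2 le_rfl (by omega), h2]
        have hS := Fml.holds_selfReduces (w := w) (M := M) (X := k) (by omega)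
          (e := fun v => r (v + 2))
        refine Runs.ite (by rw [hv]; split_ifs <;> simp) (fun h => Runs.skip ?_)
          (fun h => (Runs.const ?_).mono (by simp) fun _ => id)
        · have hk' : SelfReducesAt w k := by
            by_contra hc
            exact h (by rw [hv, if_neg (fun hh => hc (hS.1 hh))])
          refine ⟨by omega, e1, e0, e2, ?_, fun i hi hi' => by rw [er i hi hi']; exact hr i hi hi'⟩
          rw [er 5 (by omega) (by omega), h5]
          congr 1
          refine propext ⟨fun h X hX hkX => ?_, fun h X hX hkX => h X hX (by omega)⟩
          rcases hkX.lt_or_eq with hlt | rfl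
          · exact h X hX hlt
          · exact hk'
        · have hk' : ¬ SelfReducesAt w k := by
            intro hc
            rw [hv, if_pos (hS.2 hc)] at h
            omega
          refine ⟨by omega, by simp [e1], by simp [e0], by simp [e2], ?_, fun i hi hi' => ?_⟩
          · rw [Function.update_self, if_neg]
            exact fun h => hk' (h k (by omega) le_rfl)
          · rw [Function.update_apply]
            split_ifs
            · omega
            · rw [er i hi hi']; exact hr i hi hi'
    · rintro r ⟨-, h1, -, -, h5, -⟩
      refine ⟨h1, Runs.copy (by omega) (by rw [h5]; split_ifs <;> simp) ?_⟩
      rw [Function.update_self, h5]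
      simp
    · refine ⟨le_rfl, h1, h0, h2, ?_, hr⟩
      rw [h5, if_pos]
      intro X hX hX'
      omega
  · have : 1 + (n + 1) + ((1 + (n + 1) + 1) + (Fml.selfReduces.cost (n + 1) + (1 + 1 + 1))) ≤
        2 * n + 10 + Fml.selfReduces.cost (n + 1) := by omega
    have := Nat.mul_le_mul_left (2 ^ M) this
    omega

theorem PolyBounded.comp_succ {f : ℕ → ℕ} (hf : PolyBounded f) :
    PolyBounded fun B => f (B + 1) := by
  obtain ⟨c, hc⟩ := hf
  refine ⟨2 * c, fun B => (hc (B + 1)).trans ?_⟩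
  rw [pow_mul]
  exact Nat.pow_le_pow_left (by nlinarith) c

theorem PolyBounded.isLittleO {f : ℕ → ℕ} (hf : PolyBounded f) :
    (fun n => (f n : ℝ)) =o[atTop] fun n => (2 : ℝ) ^ n := by
  obtain ⟨c, hc⟩ := hf
  have h1 : (fun n : ℕ => (((n + 2 : ℕ) : ℝ)) ^ c) =o[atTop] fun n : ℕ => (2 : ℝ) ^ (n + 2) :=
    (isLittleO_pow_const_const_pow_of_one_lt (R := ℝ) c (by norm_num : (1 : ℝ) < 2)).comp_tendsto
      (tendsto_add_atTop_nat 2)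
  have h2 : (fun n : ℕ => (2 : ℝ) ^ (n + 2)) =O[atTop] fun n : ℕ => (2 : ℝ) ^ n := by
    refine IsBigO.of_bound 4 (Eventually.of_forall fun n => ?_)
    rw [pow_add, Real.norm_eq_abs, Real.norm_eq_abs, abs_of_pos (by positivity),
      abs_of_pos (by positivity)]
    linarith
  refine (IsBigO.of_bound 1 (Eventually.of_forall fun n => ?_)).trans_isLittleO
    (h1.trans_isBigO h2)
  rw [one_mul, Real.norm_of_nonneg (by positivity), Real.norm_of_nonneg (by positivity)]
  exact_mod_cast hc n

/-- The property is decidable in sublinear time if polynomially many operations for each of the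
`2 ^ μ n` prescribed values are sublinear. -/
theorem sublinearTimeDecidable_satProperty {γ μ : ℕ → ℕ} (hγ : ComputableInLittleOTwoPow γ)
    (halve : Bool) (hμ : ∀ n, min (μ n) n = min (γ n) (if halve then n / 2 else n))
    (hsmall : ∀ f, PolyBounded f →
      (fun n => ((2 ^ min (μ n) n * f n : ℕ) : ℝ)) =o[atTop] fun n => (2 : ℝ) ^ n) :
    SublinearTimeDecidable (satProperty μ) := by
  classical
  obtain ⟨p, T, hT, hp⟩ := hγ
  set P : ℕ → ℕ := fun n => n * (3 * n + 7) + (2 * n + 8) + (shiftCost n (n + 1) + (6 * n + 10)) + 4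
    with hP
  have hPb : PolyBounded P := by
    have lin : ∀ a b, PolyBounded fun n => a * n + b := fun a b =>
      ((PolyBounded.const a).mul .id).add (.const b)
    exact (((PolyBounded.id.mul (lin 3 7)).add (lin 2 8)).add
      ((PolyBounded.id.shiftCost (PolyBounded.id.add (.const 1))).add (lin 6 10))).add (.const 4)
  set F : ℕ → ℕ := fun n => 2 * n + 10 + Fml.selfReduces.cost (n + 1) with hF
  have hFb : PolyBounded F :=
    (((PolyBounded.const 2).mul .id).add (.const 10)).add Fml.selfReduces.polyBounded_cost.comp_succ
  refine ⟨.seq .logTwo (.seq (.prepare p halve) .checkAll),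
    fun n => P n + 49 * T n + 2 ^ min (μ n) n * F n, ?_, fun n f => ?_⟩
  · have := (hPb.isLittleO.add (hT.const_mul_left 49)).add (hsmall F hFb)
    refine this.congr_left fun n => ?_
    push_cast
    ring
  · have key : Runs (truthTable f) (.seq .logTwo (.seq (.prepare p halve) .checkAll))
        (fun i => [2 ^ n].getD i 0) ((n * (3 * n + 7) + (2 * n + 8)) +
          ((49 * T n + (shiftCost n (n + 1) + (6 * n + 10))) + (2 ^ min (μ n) n * F n + 4)))
        (fun r => r 0 = if f ∈ satProperty μ n then 1 else 0) := by
      refine Runs.seq ((runs_logTwo _ n).mono le_rfl ?_)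
      rintro r₁ ⟨h2, h3, h14, hr⟩
      refine Runs.seq ((runs_prepare _ halve (hp n) h2 h3 h14 hr (hμ n)).mono le_rfl ?_)
      rintro r₂ ⟨h0, h1, h2, h5, hr⟩
      refine (runs_checkAll (min_le_right _ _) h0 h1 h2 h5 hr).mono le_rfl ?_
      intro r h
      rw [h]
      simp only [mem_satProperty_iff, forall_selfReducesAt_iff]
    obtain ⟨r, t, he, ht, hr⟩ := key
    refine ⟨r, t, he, ht.trans (le_of_eq ?_), ?_⟩
    · simp only [hP]
      ring
    · rw [hr]

/-! ### Circuits for padded satisfiability -/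

/-- A wire, with the input variables from `m` on replaced by the constant `0`. -/
def Wire.restrict {n k : ℕ} (m : ℕ) : Wire n k → Wire m k
  | .const b => .const b
  | .input i => if h : (i : ℕ) < m then .input ⟨i, h⟩ else .const false
  | .gate j => .gate j

/-- A circuit, with the input variables from `m` on replaced by the constant `0`. -/
def Circuit.restrict {n : ℕ} (m : ℕ) : {s : ℕ} → Circuit n s → Circuit m s
  | _, .nil => .nil
  | _, .snoc C g => .snoc (C.restrict m) ⟨g.op, g.left.restrict m, g.right.restrict m⟩

/-- The first `m` bits of `x`, followed by zeros. -/
def padZero {m : ℕ} (n : ℕ) (x : Fin m → Bool) (i : Fin n) : Bool :=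
  if h : (i : ℕ) < m then x ⟨i, h⟩ else false

theorem Wire.eval_restrict {n m k : ℕ} (W : Wire n k) (x : Fin m → Bool) (v : Fin k → Bool) :
    (W.restrict m).eval x v = W.eval (padZero n x) v := by
  cases W with
  | const b => rfl
  | input i =>
    simp only [Wire.restrict, Wire.eval, padZero]
    split_ifs <;> rfl
  | gate j => rfl

theorem Circuit.values_restrict {n m s : ℕ} (C : Circuit n s) (x : Fin m → Bool) :
    (C.restrict m).values x = C.values (padZero n x) := by
  induction C with
  | nil => rfl
  | snoc C g ih => simp only [Circuit.restrict, Circuit.values, Wire.eval_restrict, ih]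

theorem HasCircuitOfSize.mono {n : ℕ} {f : BoolFun n} {b b' : ℝ} (h : HasCircuitOfSize f b)
    (hb : b ≤ b') : HasCircuitOfSize f b' := by
  obtain ⟨s, C, out, hs, hf⟩ := h
  exact ⟨s, C, out, hs.trans hb, hf⟩

/-- Fixing variables to zero turns circuits for members of the property into circuits for
satisfiability. -/
theorem HasCircuitOfSize.SAT_of_mem {μ : ℕ → ℕ} {n m : ℕ} {f : BoolFun n} {b : ℝ}
    (hf : f ∈ satProperty μ n) (hm : m ≤ min (μ n) n) (h : HasCircuitOfSize f b) :
    HasCircuitOfSize (SAT m) b := by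
  classical
  obtain ⟨s, C, out, hs, hC⟩ := h
  refine ⟨s, C.restrict m, out.restrict m, hs, fun x => ?_⟩
  rw [Wire.eval_restrict, Circuit.values_restrict, hC,
    hf _ fun i hi => dif_neg (by omega), SAT]
  congr 1
  rw [mem_SATLanguage_iff, mem_SATLanguage_iff]
  congr 2
  funext i
  rw [le_min_iff] at hm
  by_cases hi : i < m
  · simp [hi, hi.trans_le hm.1, hi.trans_le hm.2, padZero]
  · rw [List.getD_eq_getElem?_getD, List.getD_eq_getElem?_getD,
      List.getElem?_eq_none (l := List.ofFn x) (by simpa using hi), List.getElem?_take]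
    split_ifs
    · by_cases hin : i < n
      · simp [hin, padZero, hi]
      · simp [hin]
    · rfl

/-! ### Growth -/

theorem Outstrips.min {f g l : ℕ → ℝ} (hf : Outstrips f l) (hg : Outstrips g l) :
    Outstrips (fun n => min (f n) (g n)) l := by
  intro c hc
  obtain ⟨a, ha⟩ := hf c hc
  obtain ⟨b, hb⟩ := hg c hc
  exact ⟨max a b, fun n hn => lt_min (ha n (le_of_max_le_left hn)) (hb n (le_of_max_le_right hn))⟩

theorem outstrips_logb_rpow {g : ℕ → ℝ} (hg : ∀ n : ℕ, 2 ≤ n → (n : ℝ) / 4 ≤ g n) (p : ℝ) :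
    Outstrips g fun n => Real.logb 2 n ^ p := by
  intro c hc
  have h2 : 0 < Real.log 2 := Real.log_pos one_lt_two
  have h := ((isLittleO_log_rpow_rpow_atTop p one_pos).comp_tendsto
    (tendsto_natCast_atTop_atTop (R := ℝ))).bound
    (show 0 < Real.log 2 ^ p / (8 * c) by positivity)
  obtain ⟨N, hN⟩ := eventually_atTop.1 h
  refine ⟨max N 2, fun n hn => ?_⟩
  have hn2 : 2 ≤ n := le_of_max_le_right hn
  have hn' : (2 : ℝ) ≤ n := by exact_mod_cast hn2
  have h1 := hN n (le_of_max_le_left hn)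
  have hlog : 0 ≤ Real.log n := Real.log_nonneg (by linarith)
  simp only [Function.comp_apply, Real.rpow_one, Real.norm_eq_abs] at h1
  rw [abs_of_nonneg (by positivity), abs_of_nonneg (by positivity)] at h1
  have h3 := hg n hn2
  have hp : 0 < Real.log 2 ^ p := by positivity
  simp only [Real.logb]
  rw [Real.div_rpow hlog h2.le]
  have : c * (Real.log n ^ p / Real.log 2 ^ p) ≤ n / 8 := by
    rw [← mul_div_assoc, div_le_iff₀ hp]
    calc c * Real.log n ^ p ≤ c * (Real.log 2 ^ p / (8 * c) * n) := by gcongr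
      _ = n / 8 * Real.log 2 ^ p := by field_simp
  linarith

/-- If `n - M n` outstrips the logarithm, `2 ^ M n` times a polynomial is sublinear in `2 ^ n`. -/
theorem isLittleO_two_pow_mul {M : ℕ → ℕ}
    (hM : Outstrips (fun n => (n : ℝ) - M n) fun n => Real.logb 2 n) {f : ℕ → ℕ}
    (hf : PolyBounded f) :
    (fun n => ((2 ^ min (M n) n * f n : ℕ) : ℝ)) =o[atTop] fun n => (2 : ℝ) ^ n := by
  obtain ⟨c, hc⟩ := hf
  obtain ⟨N, hN⟩ := hM (2 * (c + 1)) (by positivity)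
  have key : ∀ᶠ n : ℕ in atTop, ‖((2 ^ min (M n) n * f n : ℕ) : ℝ)‖ ≤
      1 * ‖(2 : ℝ) ^ n * ((n : ℝ) + 2)⁻¹‖ := by
    filter_upwards [eventually_ge_atTop (max N 2)] with n hn
    have hn2 : 2 ≤ n := le_of_max_le_right hn
    have h1 := hN n (le_of_max_le_left hn)
    have hn' : (2 : ℝ) ≤ n := by exact_mod_cast hn2
    have hlog : 0 ≤ Real.logb 2 n := Real.logb_nonneg one_lt_two (by linarith)
    have hMn : M n ≤ n := by
      have : (M n : ℝ) < n := by nlinarith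
      exact_mod_cast this.le
    have h2 : ((n : ℝ) + 2) ^ (c + 1) ≤ 2 ^ (n - M n) := by
      have e1 : ((n : ℝ) + 2) ^ (c + 1) ≤ (n : ℝ) ^ (2 * (c + 1)) := by
        rw [pow_mul]
        exact pow_le_pow_left₀ (by positivity) (by nlinarith) _
      have e2 : (n : ℝ) ^ (2 * (c + 1)) = 2 ^ (2 * (c + 1) * Real.logb 2 n) := by
        rw [mul_comm (2 * ((c : ℝ) + 1)), Real.rpow_mul (by norm_num),
          Real.rpow_logb (by norm_num) (by norm_num) (by positivity), ← Real.rpow_natCast]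
        push_cast
        ring_nf
      rw [e2] at e1
      refine e1.trans ?_
      rw [← Real.rpow_natCast]
      refine Real.rpow_le_rpow_of_exponent_le one_le_two ?_
      rw [Nat.cast_sub hMn]
      exact h1.le
    rw [one_mul, Real.norm_of_nonneg (by positivity), Real.norm_of_nonneg (by positivity),
      min_eq_left hMn, ← div_eq_mul_inv, le_div_iff₀ (by positivity)]
    have h3 : (f n : ℝ) ≤ ((n : ℝ) + 2) ^ c := by exact_mod_cast hc n
    push_cast
    calc (2 : ℝ) ^ M n * f n * (n + 2) ≤ 2 ^ M n * ((n : ℝ) + 2) ^ c * (n + 2) := by gcongr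
      _ = 2 ^ M n * ((n : ℝ) + 2) ^ (c + 1) := by ring
      _ ≤ 2 ^ M n * 2 ^ (n - M n) := by gcongr
      _ = 2 ^ n := by rw [← pow_add]; congr 1; omega
  refine (IsBigO.of_bound 1 key).trans_isLittleO ?_
  have h0 : (fun n : ℕ => ((n : ℝ) + 2)⁻¹) =o[atTop] fun _ => (1 : ℝ) := by
    rw [isLittleO_one_iff]
    exact tendsto_inv_atTop_zero.comp
      (tendsto_atTop_add_const_right _ _ tendsto_natCast_atTop_atTop)
  simpa using (isBigO_refl (fun n : ℕ => (2 : ℝ) ^ n) atTop).mul_isLittleO h0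

section

variable {ε : ℝ} {ν : ℕ → ℕ}

/-- If `ν` outstrips `(log n) ^ (1 / ε)`, then `2 ^ (ν n) ^ ε` is superpolynomial. -/
theorem eventually_mul_pow_le_two_rpow (hε : 0 < ε)
    (hν : Outstrips (fun n => (ν n : ℝ)) fun n => Real.logb 2 n ^ (1 / ε)) (c : ℝ) (k : ℕ) :
    ∀ᶠ n : ℕ in atTop, c * (n : ℝ) ^ k ≤ 2 ^ ((ν n : ℝ) ^ ε) := by
  obtain ⟨N, hN⟩ := hν ((k + 1 : ℝ) ^ (1 / ε)) (by positivity)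
  filter_upwards [eventually_ge_atTop N, eventually_ge_atTop 1, eventually_ge_atTop ⌈c⌉₊]
    with n h1 h2 h3
  have hn : (1 : ℝ) ≤ n := by exact_mod_cast h2
  have hlog : 0 ≤ Real.logb 2 n := Real.logb_nonneg one_lt_two hn
  have h4 := hN n h1
  rw [← Real.mul_rpow (by positivity) hlog] at h4
  have h5 : (k + 1 : ℝ) * Real.logb 2 n ≤ (ν n : ℝ) ^ ε := by
    have := Real.rpow_le_rpow (by positivity) h4.le hε.le
    rwa [← Real.rpow_mul (by positivity), one_div_mul_cancel hε.ne', Real.rpow_one] at this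
  calc c * (n : ℝ) ^ k ≤ n * (n : ℝ) ^ k := by gcongr; exact Nat.ceil_le.1 h3
    _ = (n : ℝ) ^ (k + 1) := by ring
    _ = 2 ^ ((k + 1 : ℝ) * Real.logb 2 n) := by
      rw [mul_comm, Real.rpow_mul (by norm_num), Real.rpow_logb (by norm_num) (by norm_num)
        (by positivity), ← Real.rpow_natCast]
      push_cast
      ring_nf
    _ ≤ _ := Real.rpow_le_rpow_of_exponent_le one_le_two h5

theorem tendsto_of_outstrips_logb (hε : 0 < ε)
    (hν : Outstrips (fun n => (ν n : ℝ)) fun n => Real.logb 2 n ^ (1 / ε)) :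
    Tendsto ν atTop atTop := by
  rw [← tendsto_natCast_atTop_iff (R := ℝ)]
  have h1 : Tendsto (fun n : ℕ => Real.logb 2 n ^ (1 / ε)) atTop atTop :=
    (tendsto_rpow_atTop (by positivity)).comp
      ((Real.tendsto_logb_atTop one_lt_two).comp tendsto_natCast_atTop_atTop)
  refine tendsto_atTop_mono' _ ?_ h1
  obtain ⟨N, hN⟩ := hν 1 one_pos
  filter_upwards [eventually_ge_atTop N] with n hn
  simpa using (hN n hn).le

/-- For every large `m` there is a number `n` of variables, at most exponential in `m ^ ε`, such
that the property for `n` prescribes satisfiability for codes of length `m`. -/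
theorem exists_index (hε : 0 < ε)
    (hν : Outstrips (fun n => (ν n : ℝ)) fun n => Real.logb 2 n ^ (1 / ε)) (c : ℝ) (k N : ℕ) :
    ∀ᶠ m : ℕ in atTop, ∃ n, N ≤ n ∧ m ≤ ν n ∧ c * (n : ℝ) ^ k ≤ 2 ^ ((m : ℝ) ^ ε) := by
  obtain ⟨N', hN'⟩ := hν ((2 * (k + 1 : ℝ)) ^ (1 / ε)) (by positivity)
  have hk : (0 : ℝ) < k + 1 := by positivity
  -- the largest `n` with `n ^ (k + 1) ≤ 2 ^ (m ^ ε)`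
  set F : ℕ → ℕ := fun m => ⌊(2 : ℝ) ^ ((m : ℝ) ^ ε / (k + 1))⌋₊ with hF
  have hFt : Tendsto F atTop atTop := by
    refine tendsto_nat_floor_atTop.comp ((tendsto_rpow_atTop_of_base_gt_one 2 one_lt_two).comp ?_)
    exact ((tendsto_rpow_atTop hε).comp tendsto_natCast_atTop_atTop).atTop_div_const hk
  filter_upwards [hFt.eventually_ge_atTop N, hFt.eventually_ge_atTop N', hFt.eventually_ge_atTop 2,
    hFt.eventually_ge_atTop ⌈c⌉₊] with m h1 h2 h3 h4
  refine ⟨F m, h1, ?_, ?_⟩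
  · have hn : (2 : ℝ) ≤ F m := by exact_mod_cast h3
    have hlog : 1 ≤ Real.logb 2 (F m) := by
      rw [Real.le_logb_iff_rpow_le one_lt_two (by linarith), Real.rpow_one]
      exact hn
    have h5 : (m : ℝ) ^ ε / (k + 1) ≤ 2 * Real.logb 2 (F m) := by
      have h6 : (m : ℝ) ^ ε / (k + 1) ≤ Real.logb 2 (2 * F m) := by
        rw [Real.le_logb_iff_rpow_le one_lt_two (by linarith)]
        have := (Nat.lt_floor_add_one ((2 : ℝ) ^ ((m : ℝ) ^ ε / (k + 1)))).le
        refine this.trans ?_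
        have : (F m : ℝ) = (⌊(2 : ℝ) ^ ((m : ℝ) ^ ε / (k + 1))⌋₊ : ℝ) := rfl
        linarith
      rw [Real.logb_mul (by norm_num) (by linarith), Real.logb_self_eq_one one_lt_two] at h6
      linarith
    have h7 := hN' _ h2
    rw [← Real.mul_rpow (by positivity) (by linarith)] at h7
    have h8 : (m : ℝ) ≤ (2 * (k + 1 : ℝ) * Real.logb 2 (F m)) ^ (1 / ε) := by
      have e : (m : ℝ) = ((m : ℝ) ^ ε) ^ (1 / ε) := by
        rw [← Real.rpow_mul (by positivity), mul_one_div_cancel hε.ne', Real.rpow_one]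
      rw [e]
      refine Real.rpow_le_rpow (by positivity) ?_ (by positivity)
      rw [div_le_iff₀ hk] at h5
      linarith
    have h9 : (m : ℝ) ≤ ν (F m) := h8.trans h7.le
    exact_mod_cast h9
  · calc c * (F m : ℝ) ^ k ≤ F m * (F m : ℝ) ^ k := by gcongr; exact Nat.ceil_le.1 h4
      _ = (F m : ℝ) ^ (k + 1) := by ring
      _ ≤ ((2 : ℝ) ^ ((m : ℝ) ^ ε / (k + 1))) ^ (k + 1) := by
        gcongr
        exact Nat.floor_le (by positivity)
      _ = _ := by
        rw [← Real.rpow_natCast, ← Real.rpow_mul (by norm_num)]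
        congr 1
        push_cast
        field_simp

/-! ### Usefulness, density and membership of satisfiability -/

variable {μ : ℕ → ℕ}

theorem useful_satProperty (hε : 0 < ε)
    (hμ : Outstrips (fun n => ((min (μ n) n : ℕ) : ℝ)) fun n => Real.logb 2 n ^ (1 / ε))
    (hSAT : ∀ᶠ n : ℕ in atTop, ¬ HasCircuitOfSize (SAT n) ((2 : ℝ) ^ ((n : ℝ) ^ ε))) :
    Useful InPPoly (satProperty μ) := by
  rintro f hf ⟨k, c, hc⟩
  refine hf ?_
  filter_upwards [hc, eventually_mul_pow_le_two_rpow hε hμ c k,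
    (tendsto_of_outstrips_logb hε hμ).eventually hSAT] with n h1 h2 h3 h4
  exact h3 ((h1.mono h2).SAT_of_mem h4 le_rfl)

theorem quasiUseful_satProperty (hε : 0 < ε)
    (hμ : Outstrips (fun n => ((min (μ n) n : ℕ) : ℝ)) fun n => Real.logb 2 n ^ (1 / ε))
    (hSAT : ¬ ∀ᶠ n : ℕ in atTop, HasCircuitOfSize (SAT n) ((2 : ℝ) ^ ((n : ℝ) ^ ε))) :
    QuasiUseful InPPoly (satProperty μ) := by
  rintro f hf ⟨k, c, hc⟩
  refine hSAT ?_
  obtain ⟨N, hN⟩ := eventually_atTop.1 (hf.and hc)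
  filter_upwards [exists_index hε hμ c k N] with m hm
  obtain ⟨n, h1, h2, h3⟩ := hm
  exact ((hN n h1).2.mono h3).SAT_of_mem (hN n h1).1 h2

theorem SAT_mem_satProperty (μ : ℕ → ℕ) (n : ℕ) : SAT n ∈ satProperty μ n := by
  classical
  intro x hx
  rw [SAT]
  congr 1
  rw [mem_SATLanguage_iff, mem_SATLanguage_iff]
  congr 2
  funext i
  simp only [List.getD_eq_getElem?_getD, List.getElem?_take]
  split_ifs with hi
  · rfl
  · by_cases hin : i < n
    · simpa [hin] using hx ⟨i, hin⟩ (Nat.le_of_not_lt hi)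
    · simp [hin]

/-- The property leaves all values free except at most `2 ^ μ n`. -/
theorem density_satProperty {γ : ℕ → ℕ} (n : ℕ) (hμγ : μ n ≤ γ n) :
    (2 : ℝ) ^ (2 ^ n) * (2 : ℝ) ^ (-(2 : ℝ) ^ (γ n)) ≤ ((satProperty μ n).ncard : ℝ) := by
  classical
  let P : (Fin n → Bool) → Prop := fun x => ∀ i : Fin n, μ n ≤ (i : ℕ) → x i = false
  have hP : Fintype.card {x // P x} ≤ 2 ^ γ n := by
    have h1 : Fintype.card {x // P x} ≤ Fintype.card (Fin (μ n) → Bool) := by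
      refine Fintype.card_le_of_injective (fun x => padZero (μ n) x.1) fun x y hxy => ?_
      refine Subtype.ext (funext fun i => ?_)
      by_cases hi : (i : ℕ) < μ n
      · have := congrFun hxy ⟨i, hi⟩
        simpa [padZero] using this
      · rw [x.2 i (Nat.le_of_not_lt hi), y.2 i (Nat.le_of_not_lt hi)]
    refine h1.trans ?_
    simpa using Nat.pow_le_pow_right (show 0 < 2 by omega) hμγ
  have hcard : 2 ^ Fintype.card {x // ¬ P x} ≤ (satProperty μ n).ncard := by
    have h1 : Fintype.card ({x // ¬ P x} → Bool) ≤ Fintype.card (satProperty μ n) := by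
      refine Fintype.card_le_of_injective (fun g => ⟨fun x => if h : P x then
        decide ((List.ofFn x).take (μ n) ∈ SATLanguage) else g ⟨x, h⟩, fun x hx => ?_⟩)
        fun g g' hgg => ?_
      · simp only
        rw [dif_pos hx]
      · funext x
        have := congrFun (congrArg Subtype.val hgg) x.1
        simpa [x.2] using this
    rw [← Nat.card_coe_set_eq, Nat.card_eq_fintype_card]
    simpa using h1
  have hsum : Fintype.card {x // P x} + Fintype.card {x // ¬ P x} = 2 ^ n := by
    rw [Fintype.card_subtype_compl, ← Nat.add_sub_assoc (Fintype.card_subtype_le P),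
      Nat.add_sub_cancel_left]
    simp
  have h2 : (2 : ℝ) ^ (2 ^ n) * (2 : ℝ) ^ (-(2 : ℝ) ^ (γ n)) ≤ 2 ^ Fintype.card {x // ¬ P x} := by
    rw [← Real.rpow_natCast 2 (2 ^ n), ← Real.rpow_natCast 2 (Fintype.card {x // ¬ P x}),
      ← Real.rpow_add (by norm_num)]
    refine Real.rpow_le_rpow_of_exponent_le one_le_two ?_
    have h3 : ((Fintype.card {x // P x} : ℕ) : ℝ) ≤ 2 ^ γ n := by exact_mod_cast hP
    have h4 : ((Fintype.card {x // P x} : ℕ) : ℝ) + (Fintype.card {x // ¬ P x} : ℕ) = 2 ^ n := by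
      exact_mod_cast hsum
    push_cast
    linarith
  refine h2.trans ?_
  exact_mod_cast hcard

end

end AlmostNatural

theorem mainTheorem4 (ε : ℝ) (hε : 0 < ε)
    (hSAT : ¬ ∀ᶠ n : ℕ in atTop, HasCircuitOfSize (SAT n) ((2 : ℝ) ^ ((n : ℝ) ^ ε)))
    (γ : ℕ → ℕ) (hγcomp : ComputableInLittleOTwoPow γ)
    (hγ : Outstrips (fun n => (γ n : ℝ)) (fun n => (Real.logb 2 n) ^ (1 / ε))) :
    ∃ μ : ℕ → ℕ, (∀ n, μ n ≤ γ n) ∧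
      (Outstrips (fun n => (n : ℝ) - (γ n : ℝ)) (fun n => Real.logb 2 n) → μ = γ) ∧
      SublinearNatural (satProperty μ) (fun n => (2 : ℝ) ^ (-(2 : ℝ) ^ (γ n))) ∧
      SeparatesNPFromPPoly (satProperty μ) ∧
      ((∀ᶠ n : ℕ in atTop, ¬ HasCircuitOfSize (SAT n) ((2 : ℝ) ^ ((n : ℝ) ^ ε))) →
        Useful InPPoly (satProperty μ)) := by
  have main : ∀ (μ : ℕ → ℕ) (halve : Bool), (∀ n, μ n ≤ γ n) →
      (∀ n, min (μ n) n = min (γ n) (if halve then n / 2 else n)) →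
      Outstrips (fun n => (n : ℝ) - (μ n : ℝ)) (fun n => Real.logb 2 n) →
      SublinearNatural (satProperty μ) (fun n => (2 : ℝ) ^ (-(2 : ℝ) ^ (γ n))) ∧
      SeparatesNPFromPPoly (satProperty μ) ∧
      ((∀ᶠ n : ℕ in atTop, ¬ HasCircuitOfSize (SAT n) ((2 : ℝ) ^ ((n : ℝ) ^ ε))) →
        Useful InPPoly (satProperty μ)) := by
    intro μ halve hle hmin hsmall
    have hν : Outstrips (fun n => ((min (μ n) n : ℕ) : ℝ))
        fun n => Real.logb 2 n ^ (1 / ε) := by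
      have := hγ.min (outstrips_logb_rpow
        (g := fun n => ((if halve then n / 2 else n : ℕ) : ℝ)) (fun n hn => ?_) (1 / ε))
      · simpa only [hmin, Nat.cast_min] using this
      · have h1 : n ≤ 4 * (if halve then n / 2 else n) := by split_ifs <;> omega
        have h2 : (n : ℝ) ≤ 4 * ((if halve then n / 2 else n : ℕ) : ℝ) := by exact_mod_cast h1
        linarith
    exact ⟨⟨Filter.Eventually.of_forall fun n => density_satProperty n (hle n),
      sublinearTimeDecidable_satProperty hγcomp halve hmin fun f hf =>
        isLittleO_two_pow_mul hsmall hf⟩,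
      ⟨quasiUseful_satProperty hε hν hSAT, SAT, inNP_SAT, SAT_mem_satProperty μ⟩,
      useful_satProperty hε hν⟩
  by_cases h : Outstrips (fun n => (n : ℝ) - (γ n : ℝ)) (fun n => Real.logb 2 n)
  · exact ⟨γ, fun _ => le_rfl, fun _ => rfl, main γ false (fun _ => le_rfl) (fun n => by simp) h⟩
  · refine ⟨fun n => min (γ n) (n / 2), fun n => min_le_left _ _, fun h' => absurd h' h,
      main _ true (fun n => min_le_left _ _) (fun n => ?_) ?_⟩
    · rw [if_pos rfl]
      omega
    · have := outstrips_logb_rpow (g := fun n => (n : ℝ) - ((min (γ n) (n / 2) : ℕ) : ℝ))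
        (fun n hn => ?_) 1
      · simpa only [Real.rpow_one] using this
      · have h1 : n + 4 * min (γ n) (n / 2) ≤ 4 * n := by omega
        have h2 : (n : ℝ) + 4 * ((min (γ n) (n / 2) : ℕ) : ℝ) ≤ 4 * n := by exact_mod_cast h1
        linarith
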